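/- **Setting.** Let $\mathcal X$ be an index set and $f\sim\mathcal{GP}(0,k)$ a centered Gaussian process on $\mathcal X$ with covariance $k$, separable with respect to its canonical pseudo-metric $d(x,y)=(\mathbb E(f(x)-f(y))^2)^{1/2}$ (automatic if $\mathcal X$ is finite). In round $i=1,2,\dots$ an algorithm queries $x_i$, a measurable function of $y_1,\dots,y_{i-1}$, and observes $y_i=f(x_i)+\epsilon_i$, where the $\epsilon_i\sim\mathcal N(0,\eta^2)$, $\eta>0$, are i.i.d. and independent of $f$. Its cumulative regret is $R_t=t\sup_{x\in\mathcal X}f(x)-\sum_{i\le t}f(x_i)$. For a sequence $Z=(z_1,\dots,z_m)$ of points (repetitions allowed) let $K_Z=[k(z_j,z_l)]_{j,l}$, $k_Z(x)=[k(z_j,x)]_j$, $C_Z=K_Z+\eta^2I$, and let $$\gamma_t=\sup_{Z\in\mathcal X^t}\tfrac12\log\det(I+\eta^{-2}K_Z)$$ be the maximum information gain. With $Z=(x_1,\dots,x_{i})$ and $Y=(y_1,\dots,y_{i})$ the posterior mean and variance are $\mu_i(x)=k_Z(x)^\top C_Z^{-1}Y$ and $\sigma_i^2(x)=k(x,x)-k_Z(x)^\top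 C_Z^{-1}k_Z(x)$. Fix $a>1$ and $u>0$. Assume $k(x,x)\le\kappa$ for all $x$, with $\kappa>0$, and put $c_\eta=2\kappa/\log(1+\kappa\eta^{-2})$ (for $\kappa=1$, $c_\eta=2/\log(1+\eta^{-2})$). A *tree* consists of finite sets $\mathcal T_h\subseteq\mathcal X$ ($h\ge0$) with parent maps $\mathcal T_{h+1}\to\mathcal T_h$; for a node $x$ of depth $m$ let $p_i(x)$ be its ancestor at depth $i\le m$. Given a nondecreasing real sequence $(n_h)$ and depths $h(i)$, put $u_i=u+n_{h(i)}+\log(i^a\zeta(a))$ and $$\omega_h=\sup_{m\ge h,\ x\in\mathcal T_m}\ \sum_{i=h+1}^{m}\ell_{v_i}(p_i(x),p_{i-1}(x)),\qquad v_i=u+n_i+\log(i^a\zeta(a)),$$ where $\ell_v(x,y)=\inf\{s:\Pr[f(x)-f(y)>s]<e^{-v}\}$. The algorithm is the optimistic rule: $x_i$ maximizes $\mu_{i-1}(x)+\sigma_{i-1}(x)\sqrt{2u_i}$ over $x\in\mathcal T_{h(i)}$. **(1) General bound.** Suppose $|\mathcal T_h|\le e^{n_h}$ for all $h$, $h(\cdot)$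 is nondecreasing, and for every $x\in\mathcal X$ and $r>0$ there are infinitely many $m$ such that some $y\in\mathcal T_m$ has $d(x,y)<r$. Then with probability at least $1-2e^{-u}$, for all $t\ge1$, $$R_t\le 2\sqrt{2c_\eta\,t\,u_t\,\gamma_t}+\sum_{i=1}^t\omega_{h(i)}.\qquad(*)$$ **(2) Metric entropy.** Let $\Delta=\sup_{x,y}d(x,y)$, $\epsilon_h=\Delta2^{-h}$ and $n_h=2\log N(\mathcal X,d,\epsilon_h)$, where $N(\mathcal X,d,r)$ is the minimal number of closed $d$-balls of radius $r$ centered in $\mathcal X$ that cover $\mathcal X$. Let $\mathcal T_h$ be any $\epsilon_h$-net with $|\mathcal T_h|\le e^{n_h}$ (e.g. a minimal one), each node of depth $h+1$ having its parent within $d$-distance $\epsilon_h$, and let $h(i)=\lceil\frac12\log_2i\rceil$. Suppose $\mathcal X\subseteq[0,R]^D$, $d(x,y)\le c\|x-y\|_2^\alpha$ on $\mathcal X$ with $0<\alpha\le1$ (for $\alpha=1$: $d(x,y)=O(\|x-y\|_2)$), $k(x,x)\le\kappa$, and either $\Delta=0$ or $\Delta\ge\delta>0$. Then there is a constant $C$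 depending only on $D,R,c,\alpha,\kappa,\delta,\eta,a$ such that for every $u>0$, with probability at least $1-2e^{-u}$, $(*)$ holds for all $t\ge1$, and for all $t\ge2$ the right-hand side of $(*)$ is at most $$C\sqrt{1+u}\,\sqrt{t\,\gamma_t\log t}.$$ In particular, with high probability, $R_t=O(\sqrt{t\gamma_t\log t})$. **(3) Ornstein–Uhlenbeck process.** The conclusion of (2) holds for every $\mathcal X\subseteq[0,R]\subset\mathbb R$ and $k(x,y)=\sigma^2e^{-\theta|x-y|}$ with $\sigma,\theta>0$ (with $\kappa=\sigma^2$), if $\Delta=0$ or $\Delta\ge\delta>0$, with $C$ depending only on $R,\sigma,\theta,\delta,\eta,a$. -/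

import Mathlib

open MeasureTheory ProbabilityTheory Filter Topology

noncomputable section

/-! ### The process and the observation model -/

/-- The canonical pseudo-metric `d(x,y) = (E (f x - f y)^2)^(1/2)` of a centered process with
covariance `k`, written through `k`: `d(x,y)^2 = k(x,x) - 2 k(x,y) + k(y,y)`. -/
def canonicalDist {X : Type*} (k : X → X → ℝ) (x y : X) : ℝ :=
  Real.sqrt (k x x - 2 * k x y + k y y)

/-- `f ∼ GP(0,k)`: a Gaussian process with mean zero and covariance function `k`. -/
structure IsCenteredGP {X Ω : Type*} [MeasurableSpace Ω] (P : Measure Ω)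
    (f : X → Ω → ℝ) (k : X → X → ℝ) : Prop where
  measurable : ∀ x, Measurable (f x)
  gaussian : IsGaussianProcess f P
  mean_zero : ∀ x, ∫ ω, f x ω ∂P = 0
  covariance : ∀ x y, cov[f x, f y; P] = k x y

/-- Separability with respect to the canonical pseudo-metric: for some countable set `S` of
indices, almost surely every value `f x` is a limit of values `f (s n)` with `s n ∈ S`,
`s n → x`. (Automatic when `X` is countable, in particular when it is finite.) -/
def IsSeparableProcess {X Ω : Type*} [MeasurableSpace Ω] (P : Measure Ω)
    (f : X → Ω → ℝ) (k : X → X → ℝ) : Prop :=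
  ∃ S : Set X, S.Countable ∧ ∀ᵐ ω ∂P, ∀ x, ∃ s : ℕ → X, (∀ n, s n ∈ S) ∧
    Tendsto (fun n => canonicalDist k x (s n)) atTop (𝓝 0) ∧
    Tendsto (fun n => f (s n) ω) atTop (𝓝 (f x ω))

/-- The bandit model: a separable `f ∼ GP(0,k)`, and i.i.d. `N(0,η²)` noise variables
(`noise j` is the noise of round `j + 1`), independent of the process `f`. -/
structure IsGPBandit {X Ω : Type*} [MeasurableSpace Ω] (P : Measure Ω)
    (f : X → Ω → ℝ) (noise : ℕ → Ω → ℝ) (k : X → X → ℝ) (η : ℝ) : Prop where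
  gp : IsCenteredGP P f k
  separable : IsSeparableProcess P f k
  noise_measurable : ∀ j, Measurable (noise j)
  noise_law : ∀ j, HasLaw (noise j) (gaussianReal 0 (Real.toNNReal (η ^ 2))) P
  noise_indep : iIndepFun noise P
  noise_indep_process : IndepFun (fun ω (x : X) => f x ω) (fun ω (j : ℕ) => noise j ω) P

/-- The observation of round `j + 1` when the queried point is `x j`. -/
def observation {X Ω : Type*} (f : X → Ω → ℝ) (noise : ℕ → Ω → ℝ) (x : ℕ → Ω → X)
    (j : ℕ) (ω : Ω) : ℝ :=
  f (x j ω) ω + noise j ω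

/-- Cumulative regret `R_t = t sup_x f(x) - ∑_{i ≤ t} f(x_i)`, as an extended real number. -/
def cumRegret {X Ω : Type*} (f : X → Ω → ℝ) (x : ℕ → Ω → X) (t : ℕ) (ω : Ω) : EReal :=
  ((t : ℝ) : EReal) * (⨆ z : X, ((f z ω : ℝ) : EReal))
    - ((∑ j ∈ Finset.range t, f (x j ω) ω : ℝ) : EReal)

/-! ### Posterior, upper confidence bounds and information gain -/

/-- The covariance vector between `x` and the points `z`. -/
def covVector {X : Type*} (k : X → X → ℝ) {m : ℕ} (z : Fin m → X) (x : X) : Fin m → ℝ :=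
  fun j => k (z j) x

/-- The covariance matrix `K` of the points `z`. -/
def covMatrix {X : Type*} (k : X → X → ℝ) {m : ℕ} (z : Fin m → X) :
    Matrix (Fin m) (Fin m) ℝ :=
  Matrix.of fun j l => k (z j) (z l)

/-- `C = K + η² I`. -/
def noisyCovMatrix {X : Type*} (k : X → X → ℝ) (η : ℝ) {m : ℕ} (z : Fin m → X) :
    Matrix (Fin m) (Fin m) ℝ :=
  covMatrix k z + (η ^ 2) • (1 : Matrix (Fin m) (Fin m) ℝ)

/-- Posterior mean at `x` after the observations `y` at the points `z`. -/
def posteriorMean {X : Type*} (k : X → X → ℝ) (η : ℝ) {m : ℕ} (z : Fin m → X)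
    (y : Fin m → ℝ) (x : X) : ℝ :=
  dotProduct (covVector k z x) (Matrix.mulVec (noisyCovMatrix k η z)⁻¹ y)

/-- Posterior variance at `x` after observations at the points `z`. -/
def posteriorVar {X : Type*} (k : X → X → ℝ) (η : ℝ) {m : ℕ} (z : Fin m → X) (x : X) : ℝ :=
  k x x - dotProduct (covVector k z x)
    (Matrix.mulVec (noisyCovMatrix k η z)⁻¹ (covVector k z x))

/-- Upper confidence bound: posterior mean plus posterior deviation times `√(2v)`. -/
def ucb {X : Type*} (k : X → X → ℝ) (η : ℝ) {m : ℕ} (z : Fin m → X) (y : Fin m → ℝ)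
    (v : ℝ) (x : X) : ℝ :=
  posteriorMean k η z y x + Real.sqrt (posteriorVar k η z x) * Real.sqrt (2 * v)

/-- Information gain `½ log det (I + η⁻² K)` of the points `z`. -/
def infoGain {X : Type*} (k : X → X → ℝ) (η : ℝ) {m : ℕ} (z : Fin m → X) : ℝ :=
  1 / 2 * Real.log (Matrix.det (1 + (η ^ 2)⁻¹ • covMatrix k z))

/-- `γ_t`: the maximum information gain of `t` queries (a point may be queried repeatedly). -/
def maxInfoGain {X : Type*} (k : X → X → ℝ) (η : ℝ) (t : ℕ) : ℝ :=
  ⨆ z : Fin t → X, infoGain k η z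

/-- `c_η` for processes with variance at most `κ`. For `κ = 1` it is `2 / log (1 + η⁻²)`. -/
def infoConst (κ η : ℝ) : ℝ :=
  2 * κ / Real.log (1 + κ * (η ^ 2)⁻¹)

/-! ### Trees and discretization error -/

/-- The level sets `T h` of a tree with parent maps: `p h` sends every node of depth `h + 1` to a
node of depth `h`. A point may be a node at several depths. (A tree whose points have one depth
each is the case where `T h` holds all points of depth at most `h` and `p h x = x` for
`x ∈ T h`.) -/
def IsTree {X : Type*} (T : ℕ → Finset X) (p : ℕ → X → X) : Prop :=
  ∀ h, ∀ x ∈ T (h + 1), p h x ∈ T h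

/-- `ancestor p m i x` is the ancestor `p_i(x)` at depth `i` of the node `x` of depth `m`
(`x` itself if `m ≤ i`). -/
def ancestor {X : Type*} (p : ℕ → X → X) : ℕ → ℕ → X → X
  | 0, _, x => x
  | m + 1, i, x => if m + 1 ≤ i then x else ancestor p m i (p m x)

/-- `ℓ_u(x,y) = inf {s : P(f x - f y > s) < e^{-u}}`. -/
def incrementBound {X Ω : Type*} [MeasurableSpace Ω] (P : Measure Ω) (f : X → Ω → ℝ)
    (u : ℝ) (x y : X) : ℝ :=
  sInf {s : ℝ | P {ω | s < f x ω - f y ω} < ENNReal.ofReal (Real.exp (-u))}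

/-- `log (i^a ζ(a))`, with `ζ` the Riemann zeta function. -/
def unionCost (a : ℝ) (i : ℕ) : ℝ :=
  Real.log ((i : ℝ) ^ a * (riemannZeta (a : ℂ)).re)

/-- The level `u + n_i + log (i^a ζ(a))` used for depth `i` of the tree. -/
def depthLevel (u a : ℝ) (n : ℕ → ℝ) (i : ℕ) : ℝ :=
  u + n i + unionCost a i

/-- The level `u_i = u + n_{h(i)} + log (i^a ζ(a))` used in round `i`. -/
def roundLevel (u a : ℝ) (n : ℕ → ℝ) (depth : ℕ → ℕ) (i : ℕ) : ℝ :=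
  u + n (depth i) + unionCost a i

/-- The discretization error
`ω_h = sup_x ∑_{i > h} ℓ_{v_i}(p_i(x), p_{i-1}(x))`, the supremum being over the nodes `x`
of depth `m ≥ h`, whose chain of ancestors stops at depth `m`. -/
def discretizationError {X Ω : Type*} [MeasurableSpace Ω] (P : Measure Ω) (f : X → Ω → ℝ)
    (T : ℕ → Finset X) (p : ℕ → X → X) (v : ℕ → ℝ) (h : ℕ) : EReal :=
  ⨆ (m : ℕ) (_ : h ≤ m) (x : X) (_ : x ∈ T m),
    ((∑ i ∈ Finset.Ioc h m,
      incrementBound P f (v i) (ancestor p m i x) (ancestor p m (i - 1) x) : ℝ) : EReal)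

/-! ### The algorithm and its regret bound -/

/-- The queries `x` are made by the optimistic rule on the tree: the query `x i` of round `i + 1`
is a (measurable) function of the first `i` observations, and maximizes over `T (depth (i + 1))`
the upper confidence bound at level `v (i + 1)` given the first `i` observations. -/
structure IsUCBRun {X Ω : Type*} (f : X → Ω → ℝ) (noise : ℕ → Ω → ℝ)
    (k : X → X → ℝ) (η : ℝ) (T : ℕ → Finset X) (depth : ℕ → ℕ) (v : ℕ → ℝ)
    (x : ℕ → Ω → X) : Prop where
  nonanticipating : ∀ i, ∃ φ : (Fin i → ℝ) → X, (∀ z, MeasurableSet (φ ⁻¹' {z})) ∧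
    ∀ ω, x i ω = φ fun j => observation f noise x j ω
  mem : ∀ i ω, x i ω ∈ T (depth (i + 1))
  optimistic : ∀ i ω, ∀ z ∈ T (depth (i + 1)),
    ucb k η (fun j : Fin i => x j ω) (fun j : Fin i => observation f noise x j ω) (v (i + 1)) z
      ≤ ucb k η (fun j : Fin i => x j ω) (fun j : Fin i => observation f noise x j ω)
          (v (i + 1)) (x i ω)

/-- `2 √(2 c_η t u_t γ_t) + ∑_{i ≤ t} ω_{h(i)}`. -/
def regretBound {X Ω : Type*} [MeasurableSpace Ω] (P : Measure Ω) (f : X → Ω → ℝ)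
    (k : X → X → ℝ) (η κ u a : ℝ) (n : ℕ → ℝ) (T : ℕ → Finset X) (p : ℕ → X → X)
    (depth : ℕ → ℕ) (t : ℕ) : EReal :=
  ((2 * Real.sqrt (2 * infoConst κ η * t * roundLevel u a n depth t * maxInfoGain k η t) : ℝ) :
      EReal)
    + ∑ i ∈ Finset.Icc 1 t, discretizationError P f T p (depthLevel u a n) (depth i)

/-! ### Trees of nets -/

/-- The diameter `Δ` of the index set for the canonical pseudo-metric. -/
def canonicalDiam {X : Type*} (k : X → X → ℝ) : ℝ :=
  ⨆ q : X × X, canonicalDist k q.1 q.2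

/-- `S` is an `r`-net: the `d`-balls of radius `r` centered in `S` cover the index set. -/
def IsCanonicalNet {X : Type*} (k : X → X → ℝ) (r : ℝ) (S : Finset X) : Prop :=
  ∀ x, ∃ s ∈ S, canonicalDist k x s ≤ r

/-- The covering number `N(X,d,r)`: the least cardinality of an `r`-net. -/
def canonicalCoveringNumber {X : Type*} (k : X → X → ℝ) (r : ℝ) : ℕ :=
  sInf {m : ℕ | ∃ S : Finset X, S.card = m ∧ IsCanonicalNet k r S}

/-- `ε_h = Δ 2^{-h}`. -/
def netRadius {X : Type*} (k : X → X → ℝ) (h : ℕ) : ℝ :=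
  canonicalDiam k * (1 / 2) ^ h

/-- `n_h = 2 log N(X,d,ε_h)`, twice the metric entropy. -/
def netSize {X : Type*} (k : X → X → ℝ) (h : ℕ) : ℝ :=
  2 * Real.log (canonicalCoveringNumber k (netRadius k h))

/-- A tree of successive `ε_h`-nets with at most `e^{n_h}` nodes at depth `h` (for instance nets of
minimal cardinality), every node of depth `h + 1` having a parent within distance `ε_h` (for
instance a nearest point of `T h`). -/
structure IsNetTree {X : Type*} (k : X → X → ℝ) (T : ℕ → Finset X) (p : ℕ → X → X) : Prop where
  isTree : IsTree T p
  net : ∀ h, IsCanonicalNet k (netRadius k h) (T h)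
  card_le : ∀ h, ((T h).card : ℝ) ≤ Real.exp (netSize k h)
  dist_parent : ∀ h, ∀ x ∈ T (h + 1), canonicalDist k x (p h x) ≤ netRadius k h

/-- `h(i) = ⌈½ log₂ i⌉`. -/
def halfLogDepth (i : ℕ) : ℕ :=
  ⌈(1 / 2 : ℝ) * Real.logb 2 i⌉₊

/-- The regret guarantee, with constant `C`, of the optimistic algorithm run on any tree of nets
with depth `h(i) = ⌈½ log₂ i⌉`: for all `u > 0`, outside an event of probability at most
`2 e^{-u}` one has, for all `t ≥ 1`,
`R_t ≤ 2 √(2 c_η t u_t γ_t) + ∑_{i ≤ t} ω_{h(i)}`,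
and the right-hand side is at most `C √(1 + u) √(t γ_t log t)` for all `t ≥ 2`. -/
def NetUCBRegretGuarantee {X : Type*} (k : X → X → ℝ) (η κ a C : ℝ) : Prop :=
  ∀ (T : ℕ → Finset X) (p : ℕ → X → X), IsNetTree k T p →
  ∀ u : ℝ, 0 < u →
  ∀ (Ω : Type*) [MeasurableSpace Ω] (P : Measure Ω) [IsProbabilityMeasure P]
    (f : X → Ω → ℝ) (noise : ℕ → Ω → ℝ) (x : ℕ → Ω → X),
    IsGPBandit P f noise k η →
    IsUCBRun f noise k η T halfLogDepth (roundLevel u a (netSize k) halfLogDepth) x →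
    P {ω | ¬ ∀ t : ℕ, 1 ≤ t →
        cumRegret f x t ω ≤ regretBound P f k η κ u a (netSize k) T p halfLogDepth t}
      ≤ ENNReal.ofReal (2 * Real.exp (-u)) ∧
    ∀ t : ℕ, 2 ≤ t →
      regretBound P f k η κ u a (netSize k) T p halfLogDepth t
        ≤ ((C * Real.sqrt (1 + u) * Real.sqrt (t * maxInfoGain k η t * Real.log t) : ℝ) : EReal)

/-- The Ornstein-Uhlenbeck covariance `σ² e^{-θ|x-y|}` on a set of reals. -/
def ouKernel (σ θ : ℝ) {X : Set ℝ} (x y : X) : ℝ :=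
  σ ^ 2 * Real.exp (-θ * |(x : ℝ) - (y : ℝ)|)

end

/-! ### Gaussian tails -/

/-! The regret of a round splits into a statistical part and a discretization part. For fixed
queries, the error of the posterior mean is Gaussian with variance `posteriorVar` and independent of
the observations. For adaptive queries, following a given path is an event of the observations along
that path, and there are only finitely many paths, so the same tail bound survives
(`IsGPBandit.measure_adaptive_le`). The level `u_i` contains `n_{h(i)}` to pay for a union over the
candidate nodes and `log (i^a ζ(a))` to pay for a union over rounds. Hence all confidence intervals
hold outside probability `e^{-u}`. Then every candidate `z` satisfies `f z ≤ ucb z ≤ ucb x_i ≤ f x_i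
+ 2 σ √(2 u_i)`.

The same union bound over the edges of the tree costs the other `e^{-u}` and bounds every increment
by its quantile. Telescoping along ancestors, a deep node exceeds its ancestor at depth `h(i)` by at
most `ω_{h(i)}`; density of the tree and separability carry this to the whole index set. Summing
over rounds, Cauchy-Schwarz reduces the statistical part to the sum of posterior variances. Each
variance is at most `c_η` times one term of the information gain, because the determinant factors
one query at a time (`IsGPBandit.sum_posteriorVar_le`).

For nets, a Hölder bound on a cube makes the entropy grow at most linearly in the depth. The levels
are then linear in the depth while edge lengths halve, so `ω_h` is of order `Δ √(h+1) 2^{-h}`. With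
`2^{-h(i)} ≤ i^{-1/2}` these errors add up to order `Δ √(t log t)`. The missing factor `√γ_t` comes
from `Δ` itself: if `Δ ≥ δ`, some point has variance bounded below, and querying it bounds `γ_t`
below. -/

lemma gaussianReal_zero_Ioi_zero_le (w : NNReal) :
    gaussianReal 0 w (Set.Ioi 0) ≤ ENNReal.ofReal (1 / 2) := by
  have hneg : gaussianReal 0 w (Set.Iio 0) = gaussianReal 0 w (Set.Ioi 0) := by
    have h := gaussianReal_map_neg (μ := 0) (v := w)
    rw [neg_zero] at h
    conv_rhs => rw [← h, Measure.map_apply measurable_neg measurableSet_Ioi]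
    congr 1
    ext x
    simp
  have hdisj : Disjoint (Set.Iio (0 : ℝ)) (Set.Ioi 0) := by
    rw [Set.disjoint_left]
    intro x hx hx'
    exact lt_asymm (Set.mem_Iio.1 hx) (Set.mem_Ioi.1 hx')
  have hsum : gaussianReal 0 w (Set.Ioi 0) + gaussianReal 0 w (Set.Ioi 0) ≤ 1 := by
    conv_lhs => arg 1; rw [← hneg]
    rw [← measure_union hdisj measurableSet_Ioi]
    exact prob_le_one
  have hne : gaussianReal 0 w (Set.Ioi 0) ≠ ⊤ := measure_ne_top _ _
  rw [← ENNReal.ofReal_toReal hne] at hsum ⊢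
  apply ENNReal.ofReal_le_ofReal
  rw [← ENNReal.ofReal_add ENNReal.toReal_nonneg ENNReal.toReal_nonneg] at hsum
  have := ENNReal.ofReal_le_one.1 hsum
  linarith

/-- Translating the tail to the positive half-line multiplies the centered density by a factor at
most `e^{-v}` there, and the half-line has mass at most `1/2`. The `1/2` is needed twice: it makes
the two-sided tail at most `e^{-v}`, and it makes the one-sided tail strictly smaller than `e^{-v}`,
as the definition of `incrementBound` demands. -/
lemma gaussianReal_zero_Ioi_le (w : NNReal) {c v : ℝ} (hv : 0 ≤ v)
    (hc : c = Real.sqrt w * Real.sqrt (2 * v)) :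
    gaussianReal 0 w (Set.Ioi c) ≤ ENNReal.ofReal (1 / 2 * Real.exp (-v)) := by
  by_cases hw : w = 0
  · subst hw
    simp [hc]
  have hwpos : (0 : ℝ) < w := lt_of_le_of_ne w.2 (fun h => hw (NNReal.coe_eq_zero.1 h.symm))
  have hc0 : 0 ≤ c := by rw [hc]; positivity
  have hc2 : c ^ 2 = 2 * w * v := by
    rw [hc, mul_pow, Real.sq_sqrt hwpos.le, Real.sq_sqrt (by positivity)]
    ring
  have hshift : gaussianReal 0 w (Set.Ioi c) = gaussianReal (-c) w (Set.Ioi 0) := by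
    have h := gaussianReal_map_sub_const (μ := 0) (v := w) c
    rw [zero_sub] at h
    rw [← h, Measure.map_apply (measurable_sub_const c) measurableSet_Ioi]
    congr 1
    ext x
    simp
  have hpdf : ∀ x ∈ Set.Ioi (0 : ℝ),
      gaussianPDF (-c) w x ≤ ENNReal.ofReal (Real.exp (-v)) * gaussianPDF 0 w x := by
    intro x hx
    have hx0 : 0 < x := hx
    rw [gaussianPDF, gaussianPDF, ← ENNReal.ofReal_mul (Real.exp_pos _).le]
    apply ENNReal.ofReal_le_ofReal
    rw [gaussianPDFReal, gaussianPDFReal, mul_left_comm, ← Real.exp_add]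
    gcongr
    rw [← sub_nonneg]
    -- By `c² = 2wv` the constant terms of the two exponents cancel, leaving only the cross term.
    have : -v + -(x - 0) ^ 2 / (2 * (w : ℝ)) - -(x - -c) ^ 2 / (2 * (w : ℝ)) = x * c / w := by
      field_simp
      linear_combination hc2
    rw [this]
    positivity
  rw [hshift, gaussianReal_apply _ hw]
  calc ∫⁻ x in Set.Ioi 0, gaussianPDF (-c) w x
      ≤ ∫⁻ x in Set.Ioi 0, ENNReal.ofReal (Real.exp (-v)) * gaussianPDF 0 w x :=
        setLIntegral_mono ((measurable_gaussianPDF 0 w).const_mul _) hpdf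
    _ = ENNReal.ofReal (Real.exp (-v)) * gaussianReal 0 w (Set.Ioi 0) := by
        rw [lintegral_const_mul _ (measurable_gaussianPDF 0 w), gaussianReal_apply _ hw]
    _ ≤ ENNReal.ofReal (Real.exp (-v)) * ENNReal.ofReal (1 / 2) :=
        mul_le_mul_right (gaussianReal_zero_Ioi_zero_le w) _
    _ = ENNReal.ofReal (1 / 2 * Real.exp (-v)) := by
        rw [← ENNReal.ofReal_mul (Real.exp_pos _).le, mul_comm]

section Tail

variable {Ω : Type*} [MeasurableSpace Ω] {P : Measure Ω} {Y : Ω → ℝ}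

/-- Upper tail of a centered Gaussian variable with the sharp constant `1 / 2`. -/
lemma HasGaussianLaw.measure_sqrt_lt_le (hY : HasGaussianLaw Y P) (hmean : ∫ ω, Y ω ∂P = 0)
    {v : ℝ} (hv : 0 ≤ v) :
    P {ω | Real.sqrt Var[Y; P] * Real.sqrt (2 * v) < Y ω}
      ≤ ENNReal.ofReal (1 / 2 * Real.exp (-v)) := by
  have h := gaussianReal_zero_Ioi_le (Var[Y; P].toNNReal) hv rfl
  rw [Real.coe_toNNReal _ (variance_nonneg _ _), ← hmean, ← hY.map_eq_gaussianReal,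
    Measure.map_apply_of_aemeasurable hY.aemeasurable measurableSet_Ioi] at h
  exact h

lemma HasGaussianLaw.measure_sqrt_lt_abs_le (hY : HasGaussianLaw Y P)
    (hmean : ∫ ω, Y ω ∂P = 0) {v : ℝ} (hv : 0 ≤ v) :
    P {ω | Real.sqrt Var[Y; P] * Real.sqrt (2 * v) < |Y ω|}
      ≤ ENNReal.ofReal (Real.exp (-v)) := by
  have h1 := HasGaussianLaw.measure_sqrt_lt_le hY hmean hv
  have h2 := HasGaussianLaw.measure_sqrt_lt_le (Y := fun ω => -Y ω) hY.fun_neg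
    (by rw [integral_neg, hmean, neg_zero]) hv
  rw [variance_fun_neg] at h2
  have hsub : {ω | Real.sqrt Var[Y; P] * Real.sqrt (2 * v) < |Y ω|}
      ⊆ {ω | Real.sqrt Var[Y; P] * Real.sqrt (2 * v) < Y ω}
        ∪ {ω | Real.sqrt Var[Y; P] * Real.sqrt (2 * v) < -Y ω} := by
    intro ω hω
    have hω' : Real.sqrt Var[Y; P] * Real.sqrt (2 * v) < |Y ω| := hω
    rcases lt_abs.1 hω' with h | h
    · exact Or.inl h
    · exact Or.inr h
  refine (measure_mono hsub).trans ((measure_union_le _ _).trans ((add_le_add h1 h2).trans ?_))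
  rw [← ENNReal.ofReal_add (by positivity) (by positivity)]
  apply ENNReal.ofReal_le_ofReal
  linarith

end Tail

/-! ### Second moments of the observations -/

section Bandit

set_option linter.unusedSectionVars false

variable {X Ω : Type*} [MeasurableSpace Ω] {P : Measure Ω} [IsProbabilityMeasure P]
  {f : X → Ω → ℝ} {noise : ℕ → Ω → ℝ} {k : X → X → ℝ} {η : ℝ}

lemma IsCenteredGP.memLp (h : IsCenteredGP P f k) (x : X) : MemLp (f x) 2 P :=
  (h.gaussian.hasGaussianLaw_eval x).memLp_two

lemma IsCenteredGP.kernel_comm (h : IsCenteredGP P f k) (x y : X) : k x y = k y x := by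
  rw [← h.covariance, ← h.covariance, covariance_comm]

lemma IsCenteredGP.variance_eq (h : IsCenteredGP P f k) (x : X) : Var[f x; P] = k x x := by
  rw [← covariance_self (h.measurable x).aemeasurable, h.covariance]

lemma IsCenteredGP.kernel_self_nonneg (h : IsCenteredGP P f k) (x : X) : 0 ≤ k x x := by
  rw [← h.variance_eq]
  exact variance_nonneg _ _

lemma IsCenteredGP.variance_sub (h : IsCenteredGP P f k) (x y : X) :
    Var[fun ω => f x ω - f y ω; P] = k x x - 2 * k x y + k y y := by
  have hm : Measurable fun ω => f x ω - f y ω := (h.measurable x).sub (h.measurable y)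
  rw [← covariance_self hm.aemeasurable,
    covariance_fun_sub_fun_sub (h.memLp x) (h.memLp y) (h.memLp x) (h.memLp y),
    h.covariance, h.covariance, h.covariance, h.covariance, h.kernel_comm y x]
  ring

lemma IsCenteredGP.canonicalDist_eq (h : IsCenteredGP P f k) (x y : X) :
    canonicalDist k x y = Real.sqrt Var[fun ω => f x ω - f y ω; P] := by
  rw [h.variance_sub, canonicalDist]

/-- The quadratic form at `c` is the variance of `∑ c_i f(z_i)`. -/
lemma IsCenteredGP.covMatrix_posSemidef (h : IsCenteredGP P f k) {m : ℕ} (z : Fin m → X) :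
    (covMatrix k z).PosSemidef := by
  refine Matrix.PosSemidef.of_dotProduct_mulVec_nonneg ?_ ?_
  · ext i j
    simp [covMatrix, h.kernel_comm (z i) (z j)]
  · intro c
    have hmem : ∀ i, MemLp (fun ω => c i * f (z i) ω) 2 P := fun i => (h.memLp _).const_mul _
    have hvar : Var[fun ω => ∑ i, c i * f (z i) ω; P]
        = dotProduct (star c) (Matrix.mulVec (covMatrix k z) c) := by
      rw [← covariance_self, covariance_fun_sum_fun_sum hmem hmem]
      · simp only [dotProduct, Matrix.mulVec, covMatrix, Matrix.of_apply, Finset.mul_sum]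
        refine Finset.sum_congr rfl fun i _ => Finset.sum_congr rfl fun j _ => ?_
        rw [covariance_const_mul_left, covariance_const_mul_right, h.covariance]
        rw [Pi.star_apply, star_trivial]
        ring
      · exact (Finset.measurable_sum _ fun i _ => (h.measurable _).const_mul _).aemeasurable
    rw [← hvar]
    exact variance_nonneg _ _

lemma IsCenteredGP.noisyCovMatrix_posDef (h : IsCenteredGP P f k) (hη : 0 < η) {m : ℕ}
    (z : Fin m → X) : (noisyCovMatrix k η z).PosDef := by
  rw [noisyCovMatrix, add_comm]
  exact (Matrix.PosDef.one.smul (by positivity : 0 < η ^ 2)).add_posSemidef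
    (h.covMatrix_posSemidef z)

lemma IsCenteredGP.posteriorVar_le (h : IsCenteredGP P f k) (hη : 0 < η) {m : ℕ}
    (z : Fin m → X) (x : X) : posteriorVar k η z x ≤ k x x := by
  have := (h.noisyCovMatrix_posDef hη z).inv.posSemidef.dotProduct_mulVec_nonneg
    (covVector k z x)
  rw [star_trivial] at this
  rw [posteriorVar]
  linarith

/-- The observations made at the points `z` in a fixed order. -/
noncomputable def fixedObservation (f : X → Ω → ℝ) (noise : ℕ → Ω → ℝ) {m : ℕ} (z : Fin m → X)
    (ω : Ω) (j : Fin m) : ℝ :=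
  f (z j) ω + noise j ω

lemma IsGPBandit.measurable_fixedObservation (h : IsGPBandit P f noise k η) {m : ℕ}
    (z : Fin m → X) : Measurable (fixedObservation f noise z) :=
  measurable_pi_lambda _ fun _ => (h.gp.measurable _).add (h.noise_measurable _)

/-- The error of the posterior mean at `x` for fixed queried points. -/
noncomputable def posteriorError (f : X → Ω → ℝ) (noise : ℕ → Ω → ℝ) (k : X → X → ℝ) (η : ℝ) {m : ℕ}
    (z : Fin m → X) (x : X) (ω : Ω) : ℝ :=
  f x ω - posteriorMean k η z (fixedObservation f noise z ω) x

lemma IsGPBandit.noise_hasGaussianLaw (h : IsGPBandit P f noise k η) (j : ℕ) :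
    HasGaussianLaw (noise j) P := (h.noise_law j).hasGaussianLaw

lemma IsCenteredGP.hasGaussianLaw_points (h : IsCenteredGP P f k) {m : ℕ} (z : Fin m → X) :
    HasGaussianLaw (fun ω (j : Fin m) => f (z j) ω) P := by
  have h1 := (h.gaussian.comp_right z).hasGaussianLaw Finset.univ
  exact h1.map (ContinuousLinearMap.pi fun j =>
    ContinuousLinearMap.proj (R := ℝ) (φ := fun _ : (Finset.univ : Finset (Fin m)) => ℝ)
      ⟨j, Finset.mem_univ j⟩)

lemma IsGPBandit.hasGaussianLaw_points_noise (h : IsGPBandit P f noise k η) {m l : ℕ}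
    (z : Fin l → X) :
    HasGaussianLaw (fun ω => ((fun j : Fin l => f (z j) ω), (fun j : Fin m => noise j ω))) P := by
  refine IndepFun.hasGaussianLaw (h.gp.hasGaussianLaw_points z) ?_ ?_
  · exact (h.noise_indep.precomp Fin.val_injective).hasGaussianLaw
      fun j => h.noise_hasGaussianLaw _
  · exact h.noise_indep_process.comp
      (φ := fun (g : X → ℝ) (j : Fin l) => g (z j)) (ψ := fun (e : ℕ → ℝ) (j : Fin m) => e j)
      (measurable_pi_lambda _ fun j => measurable_pi_apply _)
      (measurable_pi_lambda _ fun j => measurable_pi_apply _)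

lemma IsGPBandit.covariance_noise_noise (h : IsGPBandit P f noise k η) (i j : ℕ) :
    cov[noise i, noise j; P] = if i = j then η ^ 2 else 0 := by
  split_ifs with hij
  · subst hij
    rw [covariance_self (h.noise_measurable i).aemeasurable, (h.noise_law i).variance_eq,
      variance_id_gaussianReal, Real.coe_toNNReal _ (sq_nonneg _)]
  · exact (h.noise_indep.indepFun hij).covariance_eq_zero (h.noise_hasGaussianLaw i).memLp_two
      (h.noise_hasGaussianLaw j).memLp_two

lemma IsGPBandit.covariance_process_noise (h : IsGPBandit P f noise k η) (x : X) (j : ℕ) :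
    cov[f x, noise j; P] = 0 :=
  (h.noise_indep_process.comp (φ := fun g : X → ℝ => g x) (ψ := fun e : ℕ → ℝ => e j)
    (measurable_pi_apply _) (measurable_pi_apply _)).covariance_eq_zero (h.gp.memLp x)
    (h.noise_hasGaussianLaw j).memLp_two

lemma IsGPBandit.memLp_fixedObservation (h : IsGPBandit P f noise k η) {m : ℕ}
    (z : Fin m → X) (j : Fin m) : MemLp (fun ω => fixedObservation f noise z ω j) 2 P :=
  (h.gp.memLp _).add (h.noise_hasGaussianLaw _).memLp_two

lemma IsGPBandit.covariance_fixedObservation (h : IsGPBandit P f noise k η) {m : ℕ}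
    (z : Fin m → X) (i j : Fin m) :
    cov[fun ω => fixedObservation f noise z ω i, fun ω => fixedObservation f noise z ω j; P]
      = noisyCovMatrix k η z i j := by
  have hf := fun x => h.gp.memLp x
  have hn := fun j => (h.noise_hasGaussianLaw j).memLp_two
  have : cov[f (z i) + noise i, f (z j) + noise j; P] = noisyCovMatrix k η z i j := by
    rw [covariance_add_left (hf _) (hn _) ((hf _).add (hn _)),
      covariance_add_right (hf _) (hf _) (hn _), covariance_add_right (hn _) (hf _) (hn _),
      h.covariance_process_noise, covariance_comm (noise i), h.covariance_process_noise,
      h.gp.covariance, h.covariance_noise_noise]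
    simp [noisyCovMatrix, covMatrix, Matrix.one_apply, Fin.val_inj]
  exact this

lemma IsGPBandit.covariance_process_fixedObservation (h : IsGPBandit P f noise k η) {m : ℕ}
    (z : Fin m → X) (x : X) (j : Fin m) :
    cov[f x, fun ω => fixedObservation f noise z ω j; P] = covVector k z x j := by
  have : cov[f x, f (z j) + noise j; P] = covVector k z x j := by
    rw [covariance_add_right (h.gp.memLp _) (h.gp.memLp _) (h.noise_hasGaussianLaw j).memLp_two,
      h.covariance_process_noise, h.gp.covariance, h.gp.kernel_comm, add_zero, covVector]
  exact this

/-- The coefficients of the posterior mean as a linear function of the observations. -/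
noncomputable def posteriorWeights (k : X → X → ℝ) (η : ℝ) {m : ℕ} (z : Fin m → X) (x : X) : Fin m → ℝ :=
  Matrix.vecMul (covVector k z x) (noisyCovMatrix k η z)⁻¹

lemma posteriorMean_eq_sum (k : X → X → ℝ) (η : ℝ) {m : ℕ} (z : Fin m → X) (y : Fin m → ℝ)
    (x : X) : posteriorMean k η z y x = ∑ j, posteriorWeights k η z x j * y j := by
  rw [posteriorMean, Matrix.dotProduct_mulVec]
  rfl

lemma IsCenteredGP.posteriorWeights_mul (h : IsCenteredGP P f k) (hη : 0 < η) {m : ℕ}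
    (z : Fin m → X) (x : X) (j : Fin m) :
    ∑ i, posteriorWeights k η z x i * noisyCovMatrix k η z i j = covVector k z x j := by
  have hdet : IsUnit (noisyCovMatrix k η z).det :=
    (h.noisyCovMatrix_posDef hη z).det_pos.ne'.isUnit
  have : Matrix.vecMul (posteriorWeights k η z x) (noisyCovMatrix k η z) = covVector k z x := by
    rw [posteriorWeights, Matrix.vecMul_vecMul, Matrix.nonsing_inv_mul _ hdet, Matrix.vecMul_one]
  exact congrFun this j

lemma IsGPBandit.memLp_posteriorMean (h : IsGPBandit P f noise k η) {m : ℕ}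
    (z : Fin m → X) (x : X) :
    MemLp (fun ω => ∑ j, posteriorWeights k η z x j * fixedObservation f noise z ω j) 2 P :=
  memLp_finsetSum _ fun j _ => (h.memLp_fixedObservation z j).const_mul _

lemma posteriorError_eq (f : X → Ω → ℝ) (noise : ℕ → Ω → ℝ) (k : X → X → ℝ) (η : ℝ) {m : ℕ}
    (z : Fin m → X) (x : X) : posteriorError f noise k η z x = fun ω =>
      f x ω - ∑ j, posteriorWeights k η z x j * fixedObservation f noise z ω j := by
  funext ω
  rw [posteriorError, posteriorMean_eq_sum]

/-- These are the normal equations of linear regression: the weights solve `w C = k_z(x)`, so the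
residual is uncorrelated with every observation. -/
lemma IsGPBandit.covariance_posteriorError (h : IsGPBandit P f noise k η) (hη : 0 < η) {m : ℕ}
    (z : Fin m → X) (x : X) (j : Fin m) :
    cov[posteriorError f noise k η z x, fun ω => fixedObservation f noise z ω j; P] = 0 := by
  rw [posteriorError_eq, covariance_fun_sub_left (h.gp.memLp x) (h.memLp_posteriorMean z x)
    (h.memLp_fixedObservation z j), h.covariance_process_fixedObservation,
    covariance_fun_sum_left (fun i => (h.memLp_fixedObservation z i).const_mul _)
    (h.memLp_fixedObservation z j)]
  simp_rw [covariance_const_mul_left, h.covariance_fixedObservation]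
  rw [h.gp.posteriorWeights_mul hη, sub_self]

lemma IsGPBandit.measurable_posteriorError (h : IsGPBandit P f noise k η) {m : ℕ}
    (z : Fin m → X) (x : X) : Measurable (posteriorError f noise k η z x) := by
  rw [posteriorError_eq]
  exact (h.gp.measurable x).sub (Finset.measurable_sum _ fun j _ =>
    ((measurable_pi_apply j).comp (h.measurable_fixedObservation z)).const_mul _)

/-- The residual is orthogonal to the posterior mean, so its variance equals its covariance with `f
x`. -/
lemma IsGPBandit.variance_posteriorError (h : IsGPBandit P f noise k η) (hη : 0 < η) {m : ℕ}
    (z : Fin m → X) (x : X) :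
    Var[posteriorError f noise k η z x; P] = posteriorVar k η z x := by
  have hmem : MemLp (posteriorError f noise k η z x) 2 P := by
    rw [posteriorError_eq]
    exact (h.gp.memLp x).sub (h.memLp_posteriorMean z x)
  rw [← covariance_self (h.measurable_posteriorError z x).aemeasurable]
  conv_lhs => arg 2; rw [posteriorError_eq]
  rw [covariance_fun_sub_right hmem (h.gp.memLp x) (h.memLp_posteriorMean z x),
    covariance_fun_sum_right (fun i => (h.memLp_fixedObservation z i).const_mul _) hmem]
  simp_rw [covariance_const_mul_right, h.covariance_posteriorError hη, mul_zero]
  rw [Finset.sum_const_zero, sub_zero, posteriorError_eq,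
    covariance_fun_sub_left (h.gp.memLp x) (h.memLp_posteriorMean z x) (h.gp.memLp x),
    covariance_fun_sum_left (fun i => (h.memLp_fixedObservation z i).const_mul _) (h.gp.memLp x)]
  simp_rw [covariance_const_mul_left, covariance_comm _ (f x),
    h.covariance_process_fixedObservation]
  rw [h.gp.covariance, posteriorVar, Matrix.dotProduct_mulVec]
  rfl

lemma IsGPBandit.posteriorVar_nonneg (h : IsGPBandit P f noise k η) (hη : 0 < η) {m : ℕ}
    (z : Fin m → X) (x : X) : 0 ≤ posteriorVar k η z x := by
  rw [← h.variance_posteriorError hη]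
  exact variance_nonneg _ _

lemma IsGPBandit.integral_posteriorError (h : IsGPBandit P f noise k η) {m : ℕ}
    (z : Fin m → X) (x : X) : ∫ ω, posteriorError f noise k η z x ω ∂P = 0 := by
  have hint : ∀ j, Integrable (fun ω => fixedObservation f noise z ω j) P :=
    fun j => (h.memLp_fixedObservation z j).integrable one_le_two
  have hobs : ∀ j, ∫ ω, fixedObservation f noise z ω j ∂P = 0 := by
    intro j
    simp only [fixedObservation]
    rw [integral_add ((h.gp.memLp _).integrable one_le_two)
      ((h.noise_hasGaussianLaw _).integrable), h.gp.mean_zero, (h.noise_law _).integral_eq]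
    simp
  rw [posteriorError_eq, integral_sub ((h.gp.memLp _).integrable one_le_two)
    ((h.memLp_posteriorMean z x).integrable one_le_two), h.gp.mean_zero,
    integral_finsetSum _ fun j _ => (hint j).const_mul _]
  simp_rw [integral_const_mul, hobs]
  simp

lemma IsGPBandit.hasGaussianLaw_posteriorError (h : IsGPBandit P f noise k η) {m : ℕ}
    (z : Fin m → X) (x : X) :
    HasGaussianLaw (fun ω => (posteriorError f noise k η z x ω, fixedObservation f noise z ω))
      P := by
  -- Prepending `x` to the queried points makes the error and the observations linear images of a
  -- single Gaussian vector.
  have h1 := h.hasGaussianLaw_points_noise (m := m) (Fin.cons x z : Fin (m + 1) → X)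
  let obs : (Fin (m + 1) → ℝ) × (Fin m → ℝ) →L[ℝ] (Fin m → ℝ) :=
    ContinuousLinearMap.pi fun j =>
      (ContinuousLinearMap.proj (R := ℝ) (φ := fun _ : Fin (m + 1) => ℝ) j.succ).comp
        (ContinuousLinearMap.fst ℝ _ _)
      + (ContinuousLinearMap.proj (R := ℝ) (φ := fun _ : Fin m => ℝ) j).comp
        (ContinuousLinearMap.snd ℝ _ _)
  let err : (Fin (m + 1) → ℝ) × (Fin m → ℝ) →L[ℝ] ℝ :=
    (ContinuousLinearMap.proj (R := ℝ) (φ := fun _ : Fin (m + 1) => ℝ) 0).comp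
        (ContinuousLinearMap.fst ℝ _ _)
      - (∑ j, posteriorWeights k η z x j •
        (ContinuousLinearMap.proj (R := ℝ) (φ := fun _ : Fin m => ℝ) j)).comp obs
  have h2 := h1.map (err.prod obs)
  have h3 : (fun ω => (posteriorError f noise k η z x ω, fixedObservation f noise z ω))
      = err.prod obs ∘ fun ω => ((fun j => f ((Fin.cons x z : Fin (m + 1) → X) j) ω),
        (fun j : Fin m => noise j ω)) := by
    funext ω
    rw [posteriorError_eq]
    ext i
    · simp [obs, err, fixedObservation]
    · simp [obs, fixedObservation]
  rw [h3]
  exact h2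

/-- Jointly Gaussian and uncorrelated vectors are independent. The `Unit`-indexed family only
presents the scalar error as a vector. -/
lemma IsGPBandit.indepFun_posteriorError (h : IsGPBandit P f noise k η) (hη : 0 < η) {m : ℕ}
    (z : Fin m → X) (x : X) :
    IndepFun (posteriorError f noise k η z x) (fixedObservation f noise z) P := by
  have h1 := h.hasGaussianLaw_posteriorError z x
  have h2 : HasGaussianLaw (fun ω => ((fun _ : Unit => posteriorError f noise k η z x ω),
      fun j => fixedObservation f noise z ω j)) P :=
    h1.map ((ContinuousLinearMap.pi fun _ : Unit => ContinuousLinearMap.fst ℝ ℝ (Fin m → ℝ)).prod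
      (ContinuousLinearMap.snd ℝ _ _))
  have h3 := h2.indepFun_of_covariance_eval (X := fun _ : Unit => posteriorError f noise k η z x)
    (Y := fun j ω => fixedObservation f noise z ω j)
    fun _ j => h.covariance_posteriorError hη z x j
  exact h3.comp (φ := fun g : Unit → ℝ => g ()) (ψ := id) (measurable_pi_apply _) measurable_id

/-- For fixed queried points, conditionally on any event of the observations, the posterior mean
is off by more than `√(2v)` posterior deviations with probability at most `e^{-v}`. -/
lemma IsGPBandit.measure_inter_posteriorError_le (h : IsGPBandit P f noise k η) (hη : 0 < η)
    {m : ℕ} (z : Fin m → X) (x : X) {v : ℝ} (hv : 0 ≤ v) {S : Set (Fin m → ℝ)}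
    (hS : MeasurableSet S) :
    P ({ω | Real.sqrt (posteriorVar k η z x) * Real.sqrt (2 * v)
        < |posteriorError f noise k η z x ω|} ∩ fixedObservation f noise z ⁻¹' S)
      ≤ ENNReal.ofReal (Real.exp (-v)) * P (fixedObservation f noise z ⁻¹' S) := by
  have hmeas : MeasurableSet {r : ℝ | Real.sqrt (posteriorVar k η z x) * Real.sqrt (2 * v) < |r|} :=
    measurableSet_lt measurable_const measurable_id.abs
  have hind := (h.indepFun_posteriorError hη z x).measure_inter_preimage_eq_mul _ _ hmeas hS
  have htail := HasGaussianLaw.measure_sqrt_lt_abs_le (h.hasGaussianLaw_posteriorError z x).fst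
    (h.integral_posteriorError z x) hv
  rw [h.variance_posteriorError hη] at htail
  refine hind.le.trans ?_
  gcongr
  exact htail

end Bandit

/-! ### The union bound over rounds -/

lemma hasSum_riemannZeta_re {a : ℝ} (ha : 1 < a) :
    HasSum (fun i : ℕ => (((i + 1 : ℕ) : ℝ) ^ a)⁻¹) (riemannZeta (a : ℂ)).re := by
  have hsum : Summable (fun i : ℕ => (((i + 1 : ℕ) : ℝ) ^ a)⁻¹) :=
    (summable_nat_add_iff 1).2 (Real.summable_nat_rpow_inv.2 ha)
  have hz : riemannZeta (a : ℂ) = ((∑' i : ℕ, (((i + 1 : ℕ) : ℝ) ^ a)⁻¹ : ℝ) : ℂ) := by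
    rw [zeta_eq_tsum_one_div_nat_add_one_cpow (by simpa using ha), Complex.ofReal_tsum]
    congr 1
    funext i
    rw [Complex.ofReal_inv, Complex.ofReal_cpow (by positivity), one_div]
    push_cast
    rfl
  rw [hz, Complex.ofReal_re]
  exact hsum.hasSum

lemma one_le_riemannZeta_re {a : ℝ} (ha : 1 < a) : 1 ≤ (riemannZeta (a : ℂ)).re := by
  have h := le_hasSum (hasSum_riemannZeta_re ha) 0 fun j _ => by positivity
  simpa using h

lemma unionCost_eq {a : ℝ} (ha : 1 < a) {i : ℕ} (hi : 1 ≤ i) :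
    unionCost a i = a * Real.log i + Real.log (riemannZeta (a : ℂ)).re := by
  have hi0 : (0 : ℝ) < i := by exact_mod_cast hi
  have hz := one_le_riemannZeta_re ha
  rw [unionCost, Real.log_mul (by positivity) (by positivity), Real.log_rpow hi0]

lemma unionCost_nonneg {a : ℝ} (ha : 1 < a) {i : ℕ} (hi : 1 ≤ i) : 0 ≤ unionCost a i := by
  rw [unionCost_eq ha hi]
  have h1 : 0 ≤ Real.log i := Real.log_natCast_nonneg i
  have h2 := Real.log_nonneg (one_le_riemannZeta_re ha)
  positivity

lemma unionCost_mono {a : ℝ} (ha : 1 < a) {i j : ℕ} (hi : 1 ≤ i) (hij : i ≤ j) :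
    unionCost a i ≤ unionCost a j := by
  rw [unionCost_eq ha hi, unionCost_eq ha (hi.trans hij)]
  have hi0 : (0 : ℝ) < i := by exact_mod_cast hi
  gcongr

lemma tsum_exp_neg_unionCost {a : ℝ} (ha : 1 < a) :
    ∑' i : ℕ, ENNReal.ofReal (Real.exp (-unionCost a (i + 1))) = 1 := by
  have hz : 0 < (riemannZeta (a : ℂ)).re := zero_lt_one.trans_le (one_le_riemannZeta_re ha)
  have h : HasSum (fun i : ℕ => Real.exp (-unionCost a (i + 1))) 1 := by
    have h1 := (hasSum_riemannZeta_re ha).mul_right ((riemannZeta (a : ℂ)).re)⁻¹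
    rw [mul_inv_cancel₀ hz.ne'] at h1
    have hfun : (fun i : ℕ => Real.exp (-unionCost a (i + 1)))
        = fun i : ℕ => (((i + 1 : ℕ) : ℝ) ^ a)⁻¹ * ((riemannZeta (a : ℂ)).re)⁻¹ := by
      funext i
      have hi : (0 : ℝ) < ((i + 1 : ℕ) : ℝ) := by positivity
      rw [unionCost, Real.exp_neg, Real.exp_log (by positivity), mul_inv]
    rw [hfun]
    exact h1
  rw [← ENNReal.ofReal_tsum_of_nonneg (fun i => (Real.exp_pos _).le) h.summable, h.tsum_eq,
    ENNReal.ofReal_one]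

/-- The common union bound for rounds and for tree levels: `c i` cancels the number `N i` of events
at stage `i`, and the remaining weights `(i+1)^{-a} / ζ(a)` sum to one. -/
lemma measure_iUnion_le_exp_neg {Ω : Type*} [MeasurableSpace Ω] (P : Measure Ω) {a : ℝ}
    (ha : 1 < a) {u : ℝ} {N c : ℕ → ℝ} (hN : ∀ i, N i ≤ Real.exp (c i)) {A : ℕ → Set Ω}
    (hA : ∀ i, P (A i)
      ≤ ENNReal.ofReal (N i) * ENNReal.ofReal (Real.exp (-(u + c i + unionCost a (i + 1))))) :
    P (⋃ i, A i) ≤ ENNReal.ofReal (Real.exp (-u)) := by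
  calc P (⋃ i, A i) ≤ ∑' i, P (A i) := measure_iUnion_le _
    _ ≤ ∑' i : ℕ, ENNReal.ofReal (Real.exp (-u))
          * ENNReal.ofReal (Real.exp (-unionCost a (i + 1))) := by
        refine ENNReal.tsum_le_tsum fun i => (hA i).trans ?_
        calc _ ≤ ENNReal.ofReal (Real.exp (c i))
              * ENNReal.ofReal (Real.exp (-(u + c i + unionCost a (i + 1)))) := by
              gcongr
              exact hN i
          _ = _ := by
              rw [← ENNReal.ofReal_mul (Real.exp_pos _).le, ← ENNReal.ofReal_mul (Real.exp_pos _).le,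
                ← Real.exp_add, ← Real.exp_add]
              congr 2
              ring
    _ = ENNReal.ofReal (Real.exp (-u)) := by
        rw [ENNReal.tsum_mul_left, tsum_exp_neg_unionCost ha, mul_one]

/-! ### Information gain -/

section InfoGain

set_option linter.unusedSectionVars false

variable {X Ω : Type*} [MeasurableSpace Ω] {P : Measure Ω} [IsProbabilityMeasure P]
  {f : X → Ω → ℝ} {noise : ℕ → Ω → ℝ} {k : X → X → ℝ} {η : ℝ}

/-- The posterior variance of the new point, plus the noise variance, is the Schur complement of the
old block. -/
lemma IsCenteredGP.det_noisyCovMatrix_succ (h : IsCenteredGP P f k) (hη : 0 < η)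
    (z : ℕ → X) (m : ℕ) :
    (noisyCovMatrix k η fun j : Fin (m + 1) => z j).det
      = (noisyCovMatrix k η fun j : Fin m => z j).det
        * (η ^ 2 + posteriorVar k η (fun j : Fin m => z j) (z m)) := by
  set A := noisyCovMatrix k η fun j : Fin m => z j with hA
  set b := covVector k (fun j : Fin m => z j) (z m) with hb
  have hdet : IsUnit A.det := (h.noisyCovMatrix_posDef hη _).det_pos.ne'.isUnit
  let : Invertible A := A.invertibleOfIsUnitDet hdet
  have hblock : (noisyCovMatrix k η fun j : Fin (m + 1) => z j).submatrix
        (finSumFinEquiv : Fin m ⊕ Fin 1 ≃ Fin (m + 1)) finSumFinEquiv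
      = Matrix.fromBlocks A (Matrix.of fun i _ => b i) (Matrix.of fun _ j => b j)
          (Matrix.of fun _ _ => k (z m) (z m) + η ^ 2) := by
    ext i j
    rcases i with i | i <;> rcases j with j | j
    · simp [A, noisyCovMatrix, covMatrix, Matrix.one_apply]
    · have hij : Fin.castAdd 1 i ≠ Fin.natAdd m j := by
        intro h'
        have := congrArg Fin.val h'
        simp at this
        omega
      simp [b, noisyCovMatrix, covMatrix, covVector, hij]
    · have hij : Fin.natAdd m i ≠ Fin.castAdd 1 j := by
        intro h'
        have := congrArg Fin.val h'
        simp at this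
        omega
      simp [b, noisyCovMatrix, covMatrix, covVector, hij, h.kernel_comm (z m)]
    · simp [noisyCovMatrix, covMatrix, Subsingleton.elim i j]
  rw [← Matrix.det_submatrix_equiv_self finSumFinEquiv, hblock, Matrix.det_fromBlocks₁₁]
  congr 1
  rw [Matrix.det_unique, posteriorVar, ← hA, ← hb, Matrix.invOf_eq_nonsing_inv]
  simp only [Matrix.sub_apply, Matrix.of_apply, Matrix.mul_apply, Matrix.mulVec, dotProduct,
    Finset.sum_mul, Finset.mul_sum]
  rw [Finset.sum_comm]
  simp only [mul_assoc]
  ring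

lemma det_one_add_smul_covMatrix (k : X → X → ℝ) (hη : 0 < η) {m : ℕ} (z : Fin m → X) :
    (1 + (η ^ 2)⁻¹ • covMatrix k z).det = ((η ^ 2)⁻¹) ^ m * (noisyCovMatrix k η z).det := by
  have : 1 + (η ^ 2)⁻¹ • covMatrix k z = (η ^ 2)⁻¹ • noisyCovMatrix k η z := by
    rw [noisyCovMatrix, smul_add, smul_smul, inv_mul_cancel₀ (by positivity), one_smul, add_comm]
  rw [this, Matrix.det_smul, Fintype.card_fin]

lemma IsGPBandit.infoGain_eq_sum (h : IsGPBandit P f noise k η) (hη : 0 < η)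
    (z : ℕ → X) (m : ℕ) :
    infoGain k η (fun j : Fin m => z j) = ∑ i ∈ Finset.range m,
      1 / 2 * Real.log (1 + (η ^ 2)⁻¹ * posteriorVar k η (fun j : Fin i => z j) (z i)) := by
  induction m with
  | zero => simp [infoGain]
  | succ m ih =>
    have hσ := h.posteriorVar_nonneg hη (fun j : Fin m => z j) (z m)
    have hpos := (h.gp.noisyCovMatrix_posDef hη fun j : Fin m => z j).det_pos
    rw [Finset.sum_range_succ, ← ih, infoGain, infoGain, det_one_add_smul_covMatrix k hη,
      det_one_add_smul_covMatrix k hη, h.gp.det_noisyCovMatrix_succ hη, ← mul_add,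
      ← Real.log_mul (by positivity) (by positivity)]
    congr 2
    rw [pow_succ]
    field_simp

lemma infoConst_pos {κ : ℝ} (hκ : 0 < κ) (hη : 0 < η) : 0 < infoConst κ η := by
  rw [infoConst]
  have : 0 < Real.log (1 + κ * (η ^ 2)⁻¹) :=
    Real.log_pos (by rw [lt_add_iff_pos_right]; positivity)
  positivity

/-- Concavity of the logarithm: on `[0, κ]` the graph of `s ↦ log (1 + η⁻² s)` lies above its chord,
whose slope is `2 / c_η`. Bernoulli's inequality with exponent `s / κ ≤ 1` is the exponentiated
form. -/
lemma le_infoConst_mul_log {κ s : ℝ} (hκ : 0 < κ) (hη : 0 < η) (hs : 0 ≤ s) (hsκ : s ≤ κ) :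
    s ≤ infoConst κ η * (1 / 2 * Real.log (1 + (η ^ 2)⁻¹ * s)) := by
  have hlog : 0 < Real.log (1 + κ * (η ^ 2)⁻¹) :=
    Real.log_pos (by rw [lt_add_iff_pos_right]; positivity)
  have hle := rpow_one_add_le_one_add_mul_self (s := κ * (η ^ 2)⁻¹) (p := s / κ)
    (by linarith [show 0 < κ * (η ^ 2)⁻¹ by positivity]) (by positivity)
    ((div_le_one hκ).2 hsκ)
  have hpos : 0 < 1 + κ * (η ^ 2)⁻¹ := by positivity
  have hle' := Real.log_le_log (Real.rpow_pos_of_pos hpos _) hle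
  rw [Real.log_rpow hpos] at hle'
  have harg : s / κ * (κ * (η ^ 2)⁻¹) = (η ^ 2)⁻¹ * s := by field_simp
  rw [harg] at hle'
  rw [infoConst]
  calc s = κ / Real.log (1 + κ * (η ^ 2)⁻¹) * (s / κ * Real.log (1 + κ * (η ^ 2)⁻¹)) := by
        generalize Real.log (1 + κ * (η ^ 2)⁻¹) = l at hlog
        field_simp
    _ ≤ κ / Real.log (1 + κ * (η ^ 2)⁻¹) * Real.log (1 + (η ^ 2)⁻¹ * s) := by gcongr
    _ = _ := by ring

lemma exists_nat_extension {t : ℕ} (ht : 1 ≤ t) (z : Fin t → X) :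
    ∃ w : ℕ → X, (fun j : Fin t => w j) = z :=
  ⟨fun i => if hi : i < t then z ⟨i, hi⟩ else z ⟨0, ht⟩, by funext j; simp⟩

lemma IsGPBandit.bddAbove_infoGain (h : IsGPBandit P f noise k η) (hη : 0 < η) {κ : ℝ}
    (hk : ∀ x, k x x ≤ κ) (t : ℕ) :
    BddAbove (Set.range fun z : Fin t → X => infoGain k η z) := by
  refine ⟨∑ i ∈ Finset.range t, 1 / 2 * Real.log (1 + (η ^ 2)⁻¹ * κ), ?_⟩
  rintro _ ⟨z, rfl⟩
  rcases Nat.eq_zero_or_pos t with rfl | ht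
  · simp [infoGain]
  · obtain ⟨w, rfl⟩ := exists_nat_extension ht z
    simp only
    rw [h.infoGain_eq_sum hη]
    refine Finset.sum_le_sum fun i _ => ?_
    have := h.posteriorVar_nonneg hη (fun j : Fin i => w j) (w i)
    have := (h.gp.posteriorVar_le hη (fun j : Fin i => w j) (w i)).trans (hk _)
    gcongr

lemma IsGPBandit.infoGain_le_maxInfoGain (h : IsGPBandit P f noise k η) (hη : 0 < η) {κ : ℝ}
    (hk : ∀ x, k x x ≤ κ) {t : ℕ} (z : Fin t → X) : infoGain k η z ≤ maxInfoGain k η t :=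
  le_ciSup (h.bddAbove_infoGain hη hk t) z

lemma IsGPBandit.sum_posteriorVar_le (h : IsGPBandit P f noise k η) (hη : 0 < η) {κ : ℝ}
    (hκ : 0 < κ) (hk : ∀ x, k x x ≤ κ) (z : ℕ → X) (t : ℕ) :
    ∑ i ∈ Finset.range t, posteriorVar k η (fun j : Fin i => z j) (z i)
      ≤ infoConst κ η * maxInfoGain k η t := by
  calc _ ≤ ∑ i ∈ Finset.range t, infoConst κ η * (1 / 2 * Real.log
          (1 + (η ^ 2)⁻¹ * posteriorVar k η (fun j : Fin i => z j) (z i))) :=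
        Finset.sum_le_sum fun i _ => le_infoConst_mul_log hκ hη (h.posteriorVar_nonneg hη _ _)
          ((h.gp.posteriorVar_le hη _ _).trans (hk _))
    _ = infoConst κ η * infoGain k η (fun j : Fin t => z j) := by
        rw [h.infoGain_eq_sum hη, Finset.mul_sum]
    _ ≤ _ := by
        gcongr
        · exact (infoConst_pos hκ hη).le
        · exact h.infoGain_le_maxInfoGain hη hk _

/-- Query `x` in every round. The first query sees the prior variance `k x x`, and the later ones
contribute nonnegative terms. -/
lemma IsGPBandit.log_le_maxInfoGain (h : IsGPBandit P f noise k η) (hη : 0 < η) {κ : ℝ}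
    (hk : ∀ x, k x x ≤ κ) (x : X) {t : ℕ} (ht : 1 ≤ t) :
    1 / 2 * Real.log (1 + (η ^ 2)⁻¹ * k x x) ≤ maxInfoGain k η t := by
  refine le_trans ?_ (h.infoGain_le_maxInfoGain hη hk fun _ : Fin t => x)
  have hsum := h.infoGain_eq_sum hη (fun _ => x) t
  rw [hsum]
  refine le_trans (le_of_eq ?_) (Finset.single_le_sum (f := fun i => 1 / 2 * Real.log
    (1 + (η ^ 2)⁻¹ * posteriorVar k η (fun _ : Fin i => x) x)) (fun i _ => ?_)
    (Finset.mem_range.2 ht))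
  · simp [posteriorVar, dotProduct]
  · have := h.posteriorVar_nonneg hη (fun _ : Fin i => x) x
    have : 0 ≤ Real.log (1 + (η ^ 2)⁻¹ * posteriorVar k η (fun _ : Fin i => x) x) :=
      Real.log_nonneg (by rw [le_add_iff_nonneg_right]; positivity)
    positivity

end InfoGain

/-! ### Posterior concentration for adaptive queries -/

section Adaptive

set_option linter.unusedSectionVars false

variable {X Ω : Type*} [MeasurableSpace Ω] {P : Measure Ω} [IsProbabilityMeasure P]
  {f : X → Ω → ℝ} {noise : ℕ → Ω → ℝ} {k : X → X → ℝ} {η : ℝ} {x : ℕ → Ω → X}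

/-- For queries depending on past observations, following a given path of queries is an event of
the observations made along this fixed path. -/
lemma exists_measurableSet_path (hx : ∀ i, ∃ φ : (Fin i → ℝ) → X,
      (∀ z, MeasurableSet (φ ⁻¹' {z})) ∧ ∀ ω, x i ω = φ fun j => observation f noise x j ω)
    {m : ℕ} (w : Fin m → X) :
    ∃ S : Set (Fin m → ℝ), MeasurableSet S ∧
      {ω | ∀ j : Fin m, x j ω = w j} = fixedObservation f noise w ⁻¹' S := by
  choose φ hφ hxφ using hx
  refine ⟨⋂ j : Fin m, (fun y : Fin m → ℝ => fun l : Fin j => y ⟨l, l.2.trans j.2⟩) ⁻¹'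
    (φ j ⁻¹' {w j}), ?_, ?_⟩
  · exact MeasurableSet.iInter fun j => (measurable_pi_lambda _ fun l => measurable_pi_apply _)
      (hφ j (w j))
  · ext ω
    simp only [Set.mem_ofPred_eq, Set.mem_preimage, Set.mem_iInter, Set.mem_singleton_iff]
    have key : ∀ j : Fin m, (∀ l : Fin m, l < j → x l ω = w l) →
        (fun l : Fin j => fixedObservation f noise w ω ⟨l, l.2.trans j.2⟩)
          = fun l : Fin j => observation f noise x l ω := by
      intro j hj
      funext l
      have := hj ⟨l, l.2.trans j.2⟩ l.2
      simp only at this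
      simp only [fixedObservation, observation, this]
    constructor
    · intro h j
      rw [key j fun l _ => h l, ← hxφ, h]
    · intro h
      -- Induction over rounds: once all earlier queries follow `w`, the actual observations are the
      -- fixed ones, so the query rule returns `w n`.
      have : ∀ n (hn : n < m), x n ω = w ⟨n, hn⟩ := by
        intro n
        induction n using Nat.strong_induction_on with
        | _ n ih =>
          intro hn
          have h1 := h ⟨n, hn⟩
          rw [key ⟨n, hn⟩ fun l hl => ih l hl l.2, ← hxφ] at h1
          exact h1
      exact fun j => this j j.2

lemma posteriorError_eq_of_path {m : ℕ} {w : Fin m → X} {ω : Ω}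
    (hw : ∀ j : Fin m, x j ω = w j) (z : X) :
    f z ω - posteriorMean k η (fun j : Fin m => x j ω)
      (fun j : Fin m => observation f noise x j ω) z = posteriorError f noise k η w z ω := by
  have h1 : (fun j : Fin m => x j ω) = w := funext hw
  have h2 : (fun j : Fin m => observation f noise x j ω) = fixedObservation f noise w ω := by
    funext j
    simp only [observation, fixedObservation, hw]
  rw [posteriorError, h1, h2]

/-- The posterior mean at a point, computed from adaptive queries in finite sets, is off by more
than `√(2v)` posterior deviations with probability at most `e^{-v}`. -/
lemma IsGPBandit.measure_adaptive_le (h : IsGPBandit P f noise k η) (hη : 0 < η)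
    (hx : ∀ i, ∃ φ : (Fin i → ℝ) → X,
      (∀ z, MeasurableSet (φ ⁻¹' {z})) ∧ ∀ ω, x i ω = φ fun j => observation f noise x j ω)
    {S : ℕ → Finset X} (hS : ∀ i ω, x i ω ∈ S i) (m : ℕ) (z : X) {v : ℝ} (hv : 0 ≤ v) :
    P {ω | Real.sqrt (posteriorVar k η (fun j : Fin m => x j ω) z) * Real.sqrt (2 * v)
        < |f z ω - posteriorMean k η (fun j : Fin m => x j ω)
          (fun j : Fin m => observation f noise x j ω) z|}
      ≤ ENNReal.ofReal (Real.exp (-v)) := by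
  classical
  choose B hBm hB using fun w : Fin m → X => exists_measurableSet_path (f := f) (noise := noise) hx w
  let W : Finset (Fin m → X) := Fintype.piFinset fun j : Fin m => S j
  have hcover : {ω | Real.sqrt (posteriorVar k η (fun j : Fin m => x j ω) z) * Real.sqrt (2 * v)
        < |f z ω - posteriorMean k η (fun j : Fin m => x j ω)
          (fun j : Fin m => observation f noise x j ω) z|}
      ⊆ ⋃ w ∈ W, ({ω | Real.sqrt (posteriorVar k η w z) * Real.sqrt (2 * v)
        < |posteriorError f noise k η w z ω|} ∩ fixedObservation f noise w ⁻¹' (B w)) := by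
    intro ω hω
    have hω' : Real.sqrt (posteriorVar k η (fun j : Fin m => x j ω) z) * Real.sqrt (2 * v)
        < |f z ω - posteriorMean k η (fun j : Fin m => x j ω)
          (fun j : Fin m => observation f noise x j ω) z| := hω
    refine Set.mem_iUnion₂.2 ⟨fun j => x j ω, Fintype.mem_piFinset.2 fun j => hS j ω, ?_, ?_⟩
    · rw [posteriorError_eq_of_path (fun _ => rfl)] at hω'
      exact hω'
    · rw [← hB]
      exact fun _ => rfl
  -- A sample point follows one path only, so the path probabilities sum to at most one and the
  -- union over paths costs nothing.
  have hdisj : (W : Set (Fin m → X)).PairwiseDisjoint fun w => fixedObservation f noise w ⁻¹' (B w) := by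
    intro w _ w' _ hww'
    rw [Function.onFun, Set.disjoint_left]
    intro ω h1 h2
    rw [← hB] at h1 h2
    exact hww' (funext fun j => (h1 j).symm.trans (h2 j))
  calc _ ≤ ∑ w ∈ W, P ({ω | Real.sqrt (posteriorVar k η w z) * Real.sqrt (2 * v)
        < |posteriorError f noise k η w z ω|} ∩ fixedObservation f noise w ⁻¹' (B w)) :=
        (measure_mono hcover).trans (measure_biUnion_finset_le _ _)
    _ ≤ ∑ w ∈ W, ENNReal.ofReal (Real.exp (-v)) * P (fixedObservation f noise w ⁻¹' (B w)) :=
        Finset.sum_le_sum fun w _ => h.measure_inter_posteriorError_le hη w z hv (hBm w)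
    _ = ENNReal.ofReal (Real.exp (-v)) * P (⋃ w ∈ W, fixedObservation f noise w ⁻¹' (B w)) := by
        rw [← Finset.mul_sum, measure_biUnion_finset hdisj fun w _ =>
          h.measurable_fixedObservation w (hBm w)]
    _ ≤ ENNReal.ofReal (Real.exp (-v)) := mul_le_of_le_one_right' prob_le_one

/-- With probability at least `1 - e^{-u}`, the confidence intervals of all rounds hold at all
candidate points. -/
lemma IsGPBandit.measure_confidence_le (h : IsGPBandit P f noise k η) (hη : 0 < η) {a : ℝ}
    (ha : 1 < a) {u : ℝ} (hu : 0 < u) {n : ℕ → ℝ} (hn : ∀ i, 0 ≤ n i) {T : ℕ → Finset X}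
    (hT : ∀ i, ((T i).card : ℝ) ≤ Real.exp (n i)) {depth : ℕ → ℕ}
    (hx : IsUCBRun f noise k η T depth (roundLevel u a n depth) x) :
    P (⋃ i, {ω | ∃ z ∈ T (depth (i + 1)),
        Real.sqrt (posteriorVar k η (fun j : Fin i => x j ω) z)
            * Real.sqrt (2 * roundLevel u a n depth (i + 1))
          < |f z ω - posteriorMean k η (fun j : Fin i => x j ω)
            (fun j : Fin i => observation f noise x j ω) z|})
      ≤ ENNReal.ofReal (Real.exp (-u)) := by
  refine measure_iUnion_le_exp_neg P ha (fun i => hT (depth (i + 1))) fun i => ?_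
  have hv : 0 ≤ roundLevel u a n depth (i + 1) :=
    add_nonneg (add_nonneg hu.le (hn _)) (unionCost_nonneg ha (by omega))
  have hsub : {ω | ∃ z ∈ T (depth (i + 1)),
        Real.sqrt (posteriorVar k η (fun j : Fin i => x j ω) z)
            * Real.sqrt (2 * roundLevel u a n depth (i + 1))
          < |f z ω - posteriorMean k η (fun j : Fin i => x j ω)
            (fun j : Fin i => observation f noise x j ω) z|}
      ⊆ ⋃ z ∈ T (depth (i + 1)), {ω |
        Real.sqrt (posteriorVar k η (fun j : Fin i => x j ω) z)
            * Real.sqrt (2 * roundLevel u a n depth (i + 1))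
          < |f z ω - posteriorMean k η (fun j : Fin i => x j ω)
            (fun j : Fin i => observation f noise x j ω) z|} := by
    rintro ω ⟨z, hz, hω⟩
    exact Set.mem_iUnion₂.2 ⟨z, hz, hω⟩
  refine (measure_mono hsub).trans ((measure_biUnion_finset_le _ _).trans ?_)
  refine (Finset.sum_le_card_nsmul _ _ _ fun z _ =>
    h.measure_adaptive_le hη hx.nonanticipating hx.mem i z hv).trans ?_
  rw [nsmul_eq_mul, ENNReal.ofReal_natCast]
  rfl

end Adaptive

/-! ### Quantiles of the increments -/

section Increments

set_option linter.unusedSectionVars false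

variable {X Ω : Type*} [MeasurableSpace Ω] {P : Measure Ω} [IsProbabilityMeasure P]
  {f : X → Ω → ℝ} {k : X → X → ℝ}

lemma IsCenteredGP.integral_sub (h : IsCenteredGP P f k) (x y : X) :
    ∫ ω, (f x ω - f y ω) ∂P = 0 := by
  rw [MeasureTheory.integral_sub ((h.memLp x).integrable one_le_two)
    ((h.memLp y).integrable one_le_two), h.mean_zero, h.mean_zero, sub_zero]

lemma IsCenteredGP.mem_incrementBound_set (h : IsCenteredGP P f k) (x y : X) {v : ℝ}
    (hv : 0 ≤ v) :
    P {ω | canonicalDist k x y * Real.sqrt (2 * v) < f x ω - f y ω}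
      < ENNReal.ofReal (Real.exp (-v)) := by
  rw [h.canonicalDist_eq]
  refine (HasGaussianLaw.measure_sqrt_lt_le h.gaussian.hasGaussianLaw_fun_sub
    (h.integral_sub x y) hv).trans_lt ?_
  rw [ENNReal.ofReal_lt_ofReal_iff (Real.exp_pos _)]
  linarith [Real.exp_pos (-v)]

/-- The infimum need not belong to its defining set, but the strict tail is continuous from the
right: the event is the increasing union of the events at `b + 1/(n+1)`, each of which lies above
some admissible `s`. -/
lemma IsCenteredGP.measure_incrementBound_lt_le (h : IsCenteredGP P f k) (x y : X) {v : ℝ}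
    (hv : 0 ≤ v) :
    P {ω | incrementBound P f v x y < f x ω - f y ω} ≤ ENNReal.ofReal (Real.exp (-v)) := by
  set b := incrementBound P f v x y with hb
  have hunion : {ω | b < f x ω - f y ω}
      = ⋃ n : ℕ, {ω | b + 1 / ((n : ℝ) + 1) < f x ω - f y ω} := by
    ext ω
    simp only [Set.mem_ofPred_eq, Set.mem_iUnion]
    constructor
    · intro hω
      obtain ⟨n, hn⟩ := exists_nat_one_div_lt (sub_pos.2 hω)
      exact ⟨n, by linarith⟩
    · rintro ⟨n, hn⟩
      have : 0 < 1 / ((n : ℝ) + 1) := by positivity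
      linarith
  have hmono : Monotone fun n : ℕ => {ω | b + 1 / ((n : ℝ) + 1) < f x ω - f y ω} := by
    intro n m hnm ω hω
    have hω' : b + 1 / ((n : ℝ) + 1) < f x ω - f y ω := hω
    have hle : 1 / ((m : ℝ) + 1) ≤ 1 / ((n : ℝ) + 1) := by gcongr
    exact lt_of_le_of_lt (by linarith) hω'
  rw [hunion, hmono.measure_iUnion]
  refine iSup_le fun n => ?_
  have hlt : b < b + 1 / ((n : ℝ) + 1) := by
    rw [lt_add_iff_pos_right]
    positivity
  have hne : {s : ℝ | P {ω | s < f x ω - f y ω} < ENNReal.ofReal (Real.exp (-v))}.Nonempty :=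
    ⟨_, h.mem_incrementBound_set x y hv⟩
  obtain ⟨s, hs, hsb⟩ := exists_lt_of_csInf_lt hne hlt
  have hs' : P {ω | s < f x ω - f y ω} < ENNReal.ofReal (Real.exp (-v)) := hs
  refine le_trans (measure_mono fun ω hω => ?_) hs'.le
  exact hsb.trans hω

/-- For `v > 0` the quantile of an increment is at most `d(x,y) √(2v)`. -/
lemma IsCenteredGP.incrementBound_le (h : IsCenteredGP P f k) (x y : X) {v : ℝ} (hv : 0 < v) :
    incrementBound P f v x y ≤ canonicalDist k x y * Real.sqrt (2 * v) := by
  refine csInf_le ?_ (h.mem_incrementBound_set x y hv.le)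
  -- What remains is boundedness below, without which the real infimum would take the default value
  -- `0`. Since `v > 0`, `e^{-v} < 1`, while the probability of exceeding `-n` tends to one.
  have hmono : Monotone fun n : ℕ => {ω | -(n : ℝ) < f x ω - f y ω} := by
    intro n m hnm ω hω
    have hω' : -(n : ℝ) < f x ω - f y ω := hω
    have hle : (n : ℝ) ≤ m := by exact_mod_cast hnm
    exact lt_of_le_of_lt (by linarith) hω'
  have hunion : ⋃ n : ℕ, {ω | -(n : ℝ) < f x ω - f y ω} = Set.univ := by
    ext ω
    simp only [Set.mem_ofPred_eq, Set.mem_iUnion, Set.mem_univ, iff_true]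
    obtain ⟨n, hn⟩ := exists_nat_gt (-(f x ω - f y ω))
    exact ⟨n, by linarith⟩
  have hsup := hmono.measure_iUnion (μ := P)
  rw [hunion, measure_univ] at hsup
  have hlt : ENNReal.ofReal (Real.exp (-v)) < ⨆ n : ℕ, P {ω | -(n : ℝ) < f x ω - f y ω} := by
    rw [← hsup, ENNReal.ofReal_lt_one, Real.exp_lt_one_iff]
    linarith
  obtain ⟨n, hn⟩ := lt_iSup_iff.1 hlt
  refine ⟨-(n : ℝ), fun s hs => ?_⟩
  have hs' : P {ω | s < f x ω - f y ω} < ENNReal.ofReal (Real.exp (-v)) := hs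
  by_contra hlt'
  rw [not_le] at hlt'
  refine absurd (hn.trans_le (measure_mono fun ω hω => ?_)) hs'.not_gt
  exact hlt'.trans hω

/-! ### Approximation of the process along the tree -/

/-- One good node beyond depth `l` suffices, so no Borel-Cantelli argument is needed: Chebyshev at a
single close node bounds the failure probability by an arbitrary `δ`. -/
lemma IsCenteredGP.ae_exists_le_add (h : IsCenteredGP P f k) {T : ℕ → Finset X} (s : X)
    (hs : ∀ r > 0, ∃ᶠ m in atTop, ∃ y ∈ T m, canonicalDist k s y < r) (l : ℕ) {ε : ℝ}
    (hε : 0 < ε) : ∀ᵐ ω ∂P, ∃ m, l ≤ m ∧ ∃ y ∈ T m, f s ω ≤ f y ω + ε := by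
  rw [ae_iff]
  refine le_antisymm (ENNReal.le_of_forall_pos_le_add fun δ hδ _ => ?_) zero_le
  -- The radius `ε √δ` makes the Chebyshev quotient at most `δ`.
  obtain ⟨m, hm, y, hy, hd⟩ := (frequently_atTop.1 (hs (ε * Real.sqrt δ) (by positivity))) l
  have hvar : Var[fun ω => f s ω - f y ω; P] ≤ ε ^ 2 * δ := by
    rw [h.canonicalDist_eq, Real.sqrt_lt' (by positivity), mul_pow, Real.sq_sqrt (NNReal.coe_nonneg δ)] at hd
    exact hd.le
  have hcheb := meas_ge_le_variance_div_sq (μ := P) ((h.memLp s).sub (h.memLp y)) hε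
  have hsub : {ω | ¬ ∃ m, l ≤ m ∧ ∃ y ∈ T m, f s ω ≤ f y ω + ε}
      ⊆ {ω | ε ≤ |(f s - f y) ω - ∫ ω, (f s - f y) ω ∂P|} := by
    intro ω hω
    have hω' : ¬ ∃ m, l ≤ m ∧ ∃ y ∈ T m, f s ω ≤ f y ω + ε := hω
    have h1 : f y ω + ε < f s ω := by
      by_contra hcon
      exact hω' ⟨m, hm, y, hy, not_lt.1 hcon⟩
    have h0 : ∫ ω, (f s - f y) ω ∂P = 0 := h.integral_sub s y
    have h2 : ε ≤ |(f s - f y) ω - ∫ ω, (f s - f y) ω ∂P| := by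
      rw [h0, sub_zero, Pi.sub_apply]
      exact le_trans (by linarith) (le_abs_self _)
    exact h2
  refine (measure_mono hsub).trans (hcheb.trans ?_)
  rw [zero_add]
  refine (ENNReal.ofReal_le_ofReal ((div_le_iff₀ (by positivity)).2 ?_)).trans_eq
    ENNReal.ofReal_coe_nnreal
  rw [mul_comm]
  exact hvar

/-- Almost surely, an upper bound of the process on the deep part of a dense tree is an upper
bound on the whole index set. -/
lemma IsCenteredGP.ae_forall_le_of_tree (h : IsCenteredGP P f k)
    (hsep : IsSeparableProcess P f k) {T : ℕ → Finset X}
    (hT : ∀ x : X, ∀ r > 0, ∃ᶠ m in atTop, ∃ y ∈ T m, canonicalDist k x y < r) :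
    ∀ᵐ ω ∂P, ∀ (l : ℕ) (c : ℝ), (∀ m, l ≤ m → ∀ y ∈ T m, f y ω ≤ c) → ∀ x, f x ω ≤ c := by
  obtain ⟨S, hS, hlim⟩ := hsep
  -- Only countably many triples `(s, l, q)` occur, so one null set serves them all; separability
  -- then reaches every `x` by a limit.
  have happrox : ∀ᵐ ω ∂P, ∀ s ∈ S, ∀ l q : ℕ,
      ∃ m, l ≤ m ∧ ∃ y ∈ T m, f s ω ≤ f y ω + 1 / ((q : ℝ) + 1) := by
    rw [ae_ball_iff hS]
    intro s _
    rw [ae_all_iff]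
    intro l
    rw [ae_all_iff]
    intro q
    exact h.ae_exists_le_add s (hT s) l (by positivity)
  filter_upwards [happrox, hlim] with ω hω hlimω l c hc x
  obtain ⟨s, hsS, -, hs⟩ := hlimω x
  refine le_of_tendsto' hs fun n => ?_
  refine le_of_forall_pos_le_add fun ε hε => ?_
  obtain ⟨q, hq⟩ := exists_nat_one_div_lt hε
  obtain ⟨m, hm, y, hy, hle⟩ := hω (s n) (hsS n) l q
  linarith [hc m hm y hy]

end Increments

/-! ### Ancestors and chaining -/

section Chaining

variable {X : Type*} {p : ℕ → X → X} {T : ℕ → Finset X}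

lemma ancestor_self (p : ℕ → X → X) (m : ℕ) (x : X) : ancestor p m m x = x := by
  cases m <;> simp [ancestor]

lemma ancestor_succ_of_le {m i : ℕ} (hi : i ≤ m) (x : X) :
    ancestor p (m + 1) i x = ancestor p m i (p m x) := by
  rw [ancestor, if_neg (by omega)]

lemma ancestor_mem (hT : IsTree T p) {m i : ℕ} (hi : i ≤ m) {x : X} (hx : x ∈ T m) :
    ancestor p m i x ∈ T i := by
  induction m generalizing x with
  | zero =>
    obtain rfl : i = 0 := by omega
    rwa [ancestor_self]
  | succ m ih =>
    rcases hi.eq_or_lt with rfl | hlt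
    · rwa [ancestor_self]
    · rw [ancestor_succ_of_le (by omega)]
      exact ih (by omega) (hT m x hx)

lemma ancestor_eq_parent {m i : ℕ} (hi : i + 1 ≤ m) (x : X) :
    ancestor p m i x = p i (ancestor p m (i + 1) x) := by
  induction m generalizing x with
  | zero => omega
  | succ m ih =>
    rw [ancestor_succ_of_le (by omega)]
    rcases hi.eq_or_lt with heq | hlt
    · obtain rfl : i = m := by omega
      rw [ancestor_self, ancestor_self]
    · rw [ancestor_succ_of_le (by omega)]
      exact ih (by omega) _

lemma sum_Ioc_sub_pred (g : ℕ → ℝ) {h m : ℕ} (hm : h ≤ m) :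
    ∑ i ∈ Finset.Ioc h m, (g i - g (i - 1)) = g m - g h := by
  induction m, hm using Nat.le_induction with
  | base => simp
  | succ m hm ih =>
    rw [Finset.sum_Ioc_succ_top (by omega), ih, Nat.add_sub_cancel]
    ring

variable {Ω : Type*} [MeasurableSpace Ω] {P : Measure Ω} {f : X → Ω → ℝ}

/-- If the increments along all edges of the tree are at most their quantiles, then the process at
a node exceeds its value at the ancestor at depth `h` by at most the discretization error. -/
lemma le_ancestor_add_discretizationError (hT : IsTree T p) {v : ℕ → ℝ} {ω : Ω}
    (hω : ∀ i, ∀ y ∈ T (i + 1),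
      f y ω - f (p i y) ω ≤ incrementBound P f (v (i + 1)) y (p i y))
    {h m : ℕ} (hm : h ≤ m) {y : X} (hy : y ∈ T m) :
    ((f y ω : ℝ) : EReal)
      ≤ ((f (ancestor p m h y) ω : ℝ) : EReal) + discretizationError P f T p v h := by
  have hsum : f y ω ≤ f (ancestor p m h y) ω + ∑ i ∈ Finset.Ioc h m,
      incrementBound P f (v i) (ancestor p m i y) (ancestor p m (i - 1) y) := by
    have htel := sum_Ioc_sub_pred (fun i => f (ancestor p m i y) ω) hm
    simp only [ancestor_self] at htel
    have hle : ∑ i ∈ Finset.Ioc h m, (f (ancestor p m i y) ω - f (ancestor p m (i - 1) y) ω)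
        ≤ ∑ i ∈ Finset.Ioc h m,
          incrementBound P f (v i) (ancestor p m i y) (ancestor p m (i - 1) y) := by
      refine Finset.sum_le_sum fun i hi => ?_
      rw [Finset.mem_Ioc] at hi
      obtain ⟨j, rfl⟩ : ∃ j, i = j + 1 := ⟨i - 1, by omega⟩
      rw [Nat.add_sub_cancel, ancestor_eq_parent hi.2]
      exact hω j _ (ancestor_mem hT hi.2 hy)
    linarith
  refine (EReal.coe_le_coe_iff.2 hsum).trans ?_
  rw [EReal.coe_add]
  gcongr
  exact le_iSup₂_of_le m hm (le_iSup₂_of_le y hy le_rfl)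

/-- A node of depth exactly `h` contributes the empty sum. Nonnegativity excludes the value `⊥`. -/
lemma discretizationError_nonneg (v : ℕ → ℝ) {h : ℕ} (hT : (T h).Nonempty) :
    0 ≤ discretizationError P f T p v h := by
  obtain ⟨y, hy⟩ := hT
  refine le_iSup₂_of_le h le_rfl (le_iSup₂_of_le y hy ?_)
  simp

/-- With probability at least `1 - e^{-u}`, all increments along edges of the tree are at most
their quantiles. -/
lemma IsCenteredGP.measure_edges_le [IsProbabilityMeasure P] {k : X → X → ℝ}
    (h : IsCenteredGP P f k) {a : ℝ}
    (ha : 1 < a) {u : ℝ} (hu : 0 < u) {n : ℕ → ℝ} (hn : ∀ i, 0 ≤ n i)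
    (hT : ∀ i, ((T i).card : ℝ) ≤ Real.exp (n i)) :
    P (⋃ i, {ω | ∃ y ∈ T (i + 1), incrementBound P f (depthLevel u a n (i + 1)) y (p i y)
        < f y ω - f (p i y) ω}) ≤ ENNReal.ofReal (Real.exp (-u)) := by
  refine measure_iUnion_le_exp_neg P ha (fun i => hT (i + 1)) fun i => ?_
  have hv : 0 ≤ depthLevel u a n (i + 1) :=
    add_nonneg (add_nonneg hu.le (hn _)) (unionCost_nonneg ha (by omega))
  have hsub : {ω | ∃ y ∈ T (i + 1), incrementBound P f (depthLevel u a n (i + 1)) y (p i y)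
        < f y ω - f (p i y) ω}
      ⊆ ⋃ y ∈ T (i + 1), {ω | incrementBound P f (depthLevel u a n (i + 1)) y (p i y)
        < f y ω - f (p i y) ω} := by
    rintro ω ⟨z, hz, hω⟩
    exact Set.mem_iUnion₂.2 ⟨z, hz, hω⟩
  refine (measure_mono hsub).trans ((measure_biUnion_finset_le _ _).trans ?_)
  refine (Finset.sum_le_card_nsmul _ _ _ fun z _ =>
    h.measure_incrementBound_lt_le z (p i z) hv).trans ?_
  rw [nsmul_eq_mul, ENNReal.ofReal_natCast]
  rfl

end Chaining

/-! ### The general regret bound -/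

lemma EReal.mul_le_coe_sum_add_sum {S : EReal} {g : ℕ → ℝ} {W : ℕ → EReal}
    (hS : ∀ i, S ≤ (g i : EReal) + W (i + 1)) (t : ℕ) :
    ((t : ℝ) : EReal) * S
      ≤ ((∑ i ∈ Finset.range t, g i : ℝ) : EReal) + ∑ i ∈ Finset.Icc 1 t, W i := by
  have hcast : ((t : ℝ) : EReal) * S = t • S := by
    -- As a multiple by `t`, the product gains one copy of `S` per round, and the induction avoids
    -- distributivity in `EReal`.
    rw [EReal.nsmul_eq_mul]
    rfl
  rw [hcast]
  clear hcast
  induction t with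
  | zero => simp
  | succ t ih =>
    rw [succ_nsmul, Finset.sum_range_succ, Finset.sum_Icc_succ_top (by omega), EReal.coe_add,
      add_add_add_comm]
    exact add_le_add ih (hS t)

/-- Cauchy-Schwarz over the rounds, after replacing every level by the largest one. -/
lemma sum_sqrt_mul_sqrt_le {s v : ℕ → ℝ} (hs : ∀ i, 0 ≤ s i) {t : ℕ} {V G : ℝ} (hV : 0 ≤ V)
    (hv : ∀ i < t, v i ≤ V) (hG : ∑ i ∈ Finset.range t, s i ≤ G) :
    ∑ i ∈ Finset.range t, 2 * (Real.sqrt (s i) * Real.sqrt (2 * v i))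
      ≤ 2 * Real.sqrt (2 * V * t * G) := by
  have hG0 : 0 ≤ G := (Finset.sum_nonneg fun i _ => hs i).trans hG
  have h1 : ∑ i ∈ Finset.range t, Real.sqrt (s i) ≤ Real.sqrt (t * G) := by
    refine Real.le_sqrt_of_sq_le ?_
    refine sq_sum_le_card_mul_sum_sq.trans ?_
    rw [Finset.card_range]
    gcongr
    refine le_trans (le_of_eq (Finset.sum_congr rfl fun i _ => Real.sq_sqrt (hs i))) hG
  calc ∑ i ∈ Finset.range t, 2 * (Real.sqrt (s i) * Real.sqrt (2 * v i))
      ≤ ∑ i ∈ Finset.range t, 2 * (Real.sqrt (s i) * Real.sqrt (2 * V)) := by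
        refine Finset.sum_le_sum fun i hi => ?_
        have := hv i (Finset.mem_range.1 hi)
        gcongr
    _ = 2 * (Real.sqrt (2 * V) * ∑ i ∈ Finset.range t, Real.sqrt (s i)) := by
        rw [← Finset.mul_sum, ← Finset.sum_mul, mul_comm (Real.sqrt (2 * V))]
    _ ≤ 2 * (Real.sqrt (2 * V) * Real.sqrt (t * G)) := by gcongr
    _ = 2 * Real.sqrt (2 * V * t * G) := by
        rw [← Real.sqrt_mul (by positivity), mul_assoc (2 * V)]

section General

variable {X Ω : Type*} [MeasurableSpace Ω] {P : Measure Ω} [IsProbabilityMeasure P]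
  {f : X → Ω → ℝ} {noise : ℕ → Ω → ℝ} {k : X → X → ℝ} {η : ℝ} {x : ℕ → Ω → X}
  {T : ℕ → Finset X} {p : ℕ → X → X}

lemma IsTree.nonempty (hT : IsTree T p)
    (hdense : ∀ x : X, ∀ r > 0, ∃ᶠ m in atTop, ∃ y ∈ T m, canonicalDist k x y < r)
    (z : X) (h : ℕ) : (T h).Nonempty := by
  obtain ⟨m, hm, y, hy, -⟩ := frequently_atTop.1 (hdense z 1 one_pos) h
  exact ⟨_, ancestor_mem hT hm hy⟩

/-- Outside three events the bound is deterministic: `A` (a confidence interval fails), `E` (an edge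
increment exceeds its quantile), each of probability at most `e^{-u}`, and the null set `N` where a
bound on the deep tree does not extend to the index set. -/
theorem IsGPBandit.measure_not_cumRegret_le (hB : IsGPBandit P f noise k η) (hη : 0 < η)
    {a : ℝ} (ha : 1 < a) {κ : ℝ} (hκ : 0 < κ) (hk : ∀ x, k x x ≤ κ) {n : ℕ → ℝ}
    (hn : Monotone n) (hT : IsTree T p) (hcard : ∀ h, ((T h).card : ℝ) ≤ Real.exp (n h))
    (hdense : ∀ x : X, ∀ r > 0, ∃ᶠ m in atTop, ∃ y ∈ T m, canonicalDist k x y < r)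
    {depth : ℕ → ℕ} (hdepth : Monotone depth) {u : ℝ} (hu : 0 < u)
    (hx : IsUCBRun f noise k η T depth (roundLevel u a n depth) x) :
    P {ω | ¬ ∀ t : ℕ, 1 ≤ t → cumRegret f x t ω ≤ regretBound P f k η κ u a n T p depth t}
      ≤ ENNReal.ofReal (2 * Real.exp (-u)) := by
  have : Nonempty Ω := nonempty_of_isProbabilityMeasure P
  obtain ⟨ω₀⟩ := this
  have hne : ∀ h, (T h).Nonempty := hT.nonempty hdense (x 0 ω₀)
  -- A nonempty level has at least one node, so `1 ≤ e^{n_i}`.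
  have hn0 : ∀ i, 0 ≤ n i := by
    intro i
    have h1 : (1 : ℝ) ≤ (T i).card := by exact_mod_cast (hne i).card_pos
    exact Real.one_le_exp_iff.1 (h1.trans (hcard i))
  have hA := hB.measure_confidence_le hη ha hu hn0 hcard hx
  have hE := hB.gp.measure_edges_le (p := p) ha hu hn0 hcard
  have hsep := hB.gp.ae_forall_le_of_tree hB.separable hdense
  set A := ⋃ i, {ω | ∃ z ∈ T (depth (i + 1)),
        Real.sqrt (posteriorVar k η (fun j : Fin i => x j ω) z)
            * Real.sqrt (2 * roundLevel u a n depth (i + 1))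
          < |f z ω - posteriorMean k η (fun j : Fin i => x j ω)
            (fun j : Fin i => observation f noise x j ω) z|} with hAdef
  set E := ⋃ i, {ω | ∃ y ∈ T (i + 1), incrementBound P f (depthLevel u a n (i + 1)) y (p i y)
        < f y ω - f (p i y) ω} with hEdef
  rw [ae_iff] at hsep
  set N := {ω | ¬ ∀ (l : ℕ) (c : ℝ), (∀ m, l ≤ m → ∀ y ∈ T m, f y ω ≤ c) → ∀ x, f x ω ≤ c}
    with hNdef
  have hgood : ∀ ω, ω ∉ A → ω ∉ E → ω ∉ N → ∀ t : ℕ, 1 ≤ t →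
      cumRegret f x t ω ≤ regretBound P f k η κ u a n T p depth t := by
    intro ω hωA hωE hωN t ht
    have hconf : ∀ i, ∀ z ∈ T (depth (i + 1)),
        |f z ω - posteriorMean k η (fun j : Fin i => x j ω)
            (fun j : Fin i => observation f noise x j ω) z|
          ≤ Real.sqrt (posteriorVar k η (fun j : Fin i => x j ω) z)
            * Real.sqrt (2 * roundLevel u a n depth (i + 1)) := by
      intro i z hz
      by_contra hcon
      exact hωA (Set.mem_iUnion.2 ⟨i, z, hz, not_le.1 hcon⟩)
    have hedge : ∀ i, ∀ y ∈ T (i + 1), f y ω - f (p i y) ω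
        ≤ incrementBound P f (depthLevel u a n (i + 1)) y (p i y) := by
      intro i y hy
      by_contra hcon
      exact hωE (Set.mem_iUnion.2 ⟨i, y, hy, not_le.1 hcon⟩)
    have hlim : ∀ (l : ℕ) (c : ℝ), (∀ m, l ≤ m → ∀ y ∈ T m, f y ω ≤ c) → ∀ x, f x ω ≤ c := by
      by_contra hcon
      exact hωN hcon
    let s : ℕ → ℝ := fun i => posteriorVar k η (fun j : Fin i => x j ω) (x i ω)
    let W : ℕ → EReal := fun i => discretizationError P f T p (depthLevel u a n) (depth i)
    let g : ℕ → ℝ := fun i => f (x i ω) ω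
      + 2 * (Real.sqrt (s i) * Real.sqrt (2 * roundLevel u a n depth (i + 1)))
    have hlevel : ∀ i, ∀ z ∈ T (depth (i + 1)), f z ω ≤ g i := by
      intro i z hz
      have h1 := (abs_le.1 (hconf i z hz)).2
      have h2 := hx.optimistic i ω z hz
      have h3 := (abs_le.1 (hconf i (x i ω) (hx.mem i ω))).1
      simp only [ucb] at h2
      simp only [g, s]
      linarith
    have hsup : ∀ i, (⨆ z : X, ((f z ω : ℝ) : EReal)) ≤ (g i : EReal) + W (i + 1) := by
      intro i
      have hW0 : 0 ≤ W (i + 1) := discretizationError_nonneg _ (hne _)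
      -- The extension `hlim` speaks of real bounds, so an infinite discretization error, for which
      -- the claim is trivial, is set aside.
      by_cases htop : W (i + 1) = ⊤
      · rw [htop, EReal.coe_add_top]
        exact le_top
      obtain ⟨w, hw⟩ : ∃ w : ℝ, W (i + 1) = w :=
        ⟨(W (i + 1)).toReal, (EReal.coe_toReal htop (ne_bot_of_le_ne_bot EReal.zero_ne_bot hW0)).symm⟩
      refine iSup_le fun z => ?_
      rw [hw, ← EReal.coe_add, EReal.coe_le_coe_iff]
      refine hlim (depth (i + 1)) _ (fun m hm y hy => ?_) z
      have h1 := le_ancestor_add_discretizationError hT hedge hm hy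
      have h2 := hlevel i _ (ancestor_mem hT hm hy)
      change _ ≤ _ + W (i + 1) at h1
      rw [hw, ← EReal.coe_add, EReal.coe_le_coe_iff] at h1
      linarith
    have hmul := EReal.mul_le_coe_sum_add_sum hsup t
    have hround : ∀ i, 1 ≤ i → 0 ≤ roundLevel u a n depth i := fun i hi =>
      add_nonneg (add_nonneg hu.le (hn0 _)) (unionCost_nonneg ha hi)
    have hreal : ∑ i ∈ Finset.range t, 2 * (Real.sqrt (s i)
          * Real.sqrt (2 * roundLevel u a n depth (i + 1)))
        ≤ 2 * Real.sqrt (2 * infoConst κ η * t * roundLevel u a n depth t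
          * maxInfoGain k η t) := by
      refine (sum_sqrt_mul_sqrt_le (fun i => hB.posteriorVar_nonneg hη _ _) (hround t ht)
        (fun i hi => ?_) (hB.sum_posteriorVar_le hη hκ hk (fun i => x i ω) t)).trans_eq ?_
      · exact add_le_add (add_le_add_right (hn (hdepth (by omega))) u)
          (unionCost_mono ha (by omega) (by omega))
      · congr 2
        ring
    rw [cumRegret, regretBound]
    refine EReal.sub_le_of_le_add (hmul.trans ?_)
    rw [add_right_comm]
    refine add_le_add ?_ le_rfl
    rw [← EReal.coe_add, EReal.coe_le_coe_iff]
    simp only [g]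
    rw [Finset.sum_add_distrib]
    linarith
  have hsub : {ω | ¬ ∀ t : ℕ, 1 ≤ t →
      cumRegret f x t ω ≤ regretBound P f k η κ u a n T p depth t} ⊆ A ∪ E ∪ N := by
    intro ω hω
    by_contra hcon
    rw [Set.mem_union, Set.mem_union, not_or, not_or] at hcon
    exact hω (hgood ω hcon.1.1 hcon.1.2 hcon.2)
  calc _ ≤ P A + P E + P N := (measure_mono hsub).trans ((measure_union_le _ _).trans
        (add_le_add (measure_union_le _ _) le_rfl))
    _ ≤ ENNReal.ofReal (Real.exp (-u)) + ENNReal.ofReal (Real.exp (-u)) + 0 :=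
        add_le_add (add_le_add hA hE) hsep.le
    _ = ENNReal.ofReal (2 * Real.exp (-u)) := by
        rw [add_zero, ← ENNReal.ofReal_add (Real.exp_pos _).le (Real.exp_pos _).le, two_mul]

end General

/-! ### Nets and metric entropy -/

section Nets

variable {X : Type*} {k : X → X → ℝ} {T : ℕ → Finset X} {p : ℕ → X → X}

lemma canonicalDist_nonneg (k : X → X → ℝ) (x y : X) : 0 ≤ canonicalDist k x y :=
  Real.sqrt_nonneg _

lemma canonicalDiam_nonneg (k : X → X → ℝ) : 0 ≤ canonicalDiam k :=
  Real.iSup_nonneg fun _ => canonicalDist_nonneg _ _ _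

lemma netRadius_antitone (k : X → X → ℝ) : Antitone (netRadius k) := by
  intro i j hij
  refine mul_le_mul_of_nonneg_left ?_ (canonicalDiam_nonneg k)
  exact pow_le_pow_of_le_one (by norm_num) (by norm_num) hij

lemma canonicalCoveringNumber_le {r : ℝ} {S : Finset X} (hS : IsCanonicalNet k r S) :
    canonicalCoveringNumber k r ≤ S.card :=
  Nat.sInf_le ⟨S, rfl, hS⟩

lemma exists_minimal_net {r : ℝ} {S : Finset X} (hS : IsCanonicalNet k r S) :
    ∃ S' : Finset X, S'.card = canonicalCoveringNumber k r ∧ IsCanonicalNet k r S' :=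
  Nat.sInf_mem (s := {m : ℕ | ∃ S : Finset X, S.card = m ∧ IsCanonicalNet k r S})
    ⟨S.card, S, rfl, hS⟩

/-- A finer net is also a coarser one. The tree supplies finite nets at all depths, so no covering
number is the default infimum `0` of an empty set. -/
lemma IsNetTree.netSize_mono [Nonempty X] (hT : IsNetTree k T p) : Monotone (netSize k) := by
  intro i j hij
  obtain ⟨S, hS, hnet⟩ := exists_minimal_net (hT.net j)
  obtain ⟨S', hS', hnet'⟩ := exists_minimal_net (hT.net i)
  have hle : canonicalCoveringNumber k (netRadius k i)
      ≤ canonicalCoveringNumber k (netRadius k j) := by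
    rw [← hS]
    refine canonicalCoveringNumber_le fun x => ?_
    obtain ⟨s, hs, hd⟩ := hnet x
    exact ⟨s, hs, hd.trans (netRadius_antitone k hij)⟩
  have hpos : 0 < canonicalCoveringNumber k (netRadius k i) := by
    rw [← hS', Finset.card_pos]
    obtain ⟨s, hs, -⟩ := hnet' (Classical.arbitrary X)
    exact ⟨s, hs⟩
  have hpos' : (0 : ℝ) < canonicalCoveringNumber k (netRadius k i) := by exact_mod_cast hpos
  rw [netSize, netSize]
  gcongr

lemma IsNetTree.dense (hT : IsNetTree k T p) (x : X) (r : ℝ) (hr : 0 < r) :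
    ∃ᶠ m in atTop, ∃ y ∈ T m, canonicalDist k x y < r := by
  have hlim : Tendsto (netRadius k) atTop (𝓝 0) := by
    have h := (tendsto_pow_atTop_nhds_zero_of_lt_one (r := (1 / 2 : ℝ)) (by norm_num)
      (by norm_num)).const_mul (canonicalDiam k)
    rwa [mul_zero] at h
  refine Eventually.frequently ?_
  filter_upwards [hlim.eventually_lt_const hr] with m hm
  obtain ⟨y, hy, hd⟩ := hT.net m x
  exact ⟨y, hy, hd.trans_lt hm⟩

end Nets

/-! ### The depth of the tree used in each round -/

lemma halfLogDepth_mono : Monotone halfLogDepth := by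
  intro i j hij
  rcases Nat.eq_zero_or_pos i with rfl | hi
  · simp [halfLogDepth]
  · refine Nat.ceil_mono ?_
    have hi0 : (0 : ℝ) < i := by exact_mod_cast hi
    have hle : (i : ℝ) ≤ j := by exact_mod_cast hij
    have := Real.logb_le_logb_of_le one_lt_two hi0 hle
    linarith

lemma half_pow_halfLogDepth_le {i : ℕ} (hi : 1 ≤ i) :
    (1 / 2 : ℝ) ^ halfLogDepth i ≤ 1 / Real.sqrt i := by
  have hi0 : (0 : ℝ) < i := by exact_mod_cast hi
  rw [one_div_pow]
  refine one_div_le_one_div_of_le (Real.sqrt_pos.2 hi0) ?_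
  have h1 : (2 : ℝ) ^ ((1 / 2 : ℝ) * Real.logb 2 i) = Real.sqrt i := by
    rw [mul_comm, Real.rpow_mul two_pos.le, Real.rpow_logb two_pos (by norm_num) hi0,
      Real.sqrt_eq_rpow]
  rw [← h1, ← Real.rpow_natCast]
  exact Real.rpow_le_rpow_of_exponent_le one_le_two (Nat.le_ceil _)

lemma two_thirds_le_log {t : ℕ} (ht : 2 ≤ t) : 2 / 3 ≤ Real.log t := by
  have h2 : (2 : ℝ) ≤ t := by exact_mod_cast ht
  have := Real.log_le_log two_pos h2
  linarith [Real.log_two_gt_d9]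

lemma halfLogDepth_add_one_le {i t : ℕ} (hi : 1 ≤ i) (hit : i ≤ t) (ht : 2 ≤ t) :
    (halfLogDepth i : ℝ) + 1 ≤ 4 * Real.log t := by
  have hi0 : (1 : ℝ) ≤ i := by exact_mod_cast hi
  have hlog : Real.log i ≤ Real.log t :=
    Real.log_le_log (by linarith) (by exact_mod_cast hit)
  have hlog0 : 0 ≤ Real.log i := Real.log_nonneg hi0
  have hlogb : Real.logb 2 i ≤ 2 * Real.log i := by
    rw [Real.logb, div_le_iff₀ (by positivity)]
    nlinarith [Real.log_two_gt_d9]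
  have hceil : (halfLogDepth i : ℝ) < (1 / 2 : ℝ) * Real.logb 2 i + 1 :=
    Nat.ceil_lt_add_one (by have := Real.logb_nonneg one_lt_two hi0; positivity)
  -- The left side is at most `log t + 2`, and `2 ≤ 3 log t` for `t ≥ 2`.
  linarith [two_thirds_le_log ht]

lemma sum_one_div_sqrt_le (t : ℕ) :
    ∑ i ∈ Finset.Icc 1 t, 1 / Real.sqrt i ≤ 2 * Real.sqrt t := by
  induction t with
  | zero => simp
  | succ t ih =>
    rw [Finset.sum_Icc_succ_top (by omega)]
    have hpos : 0 < Real.sqrt ((t + 1 : ℕ) : ℝ) := Real.sqrt_pos.2 (by positivity)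
    have hsq : Real.sqrt ((t + 1 : ℕ) : ℝ) ^ 2 = t + 1 := by
      rw [Real.sq_sqrt (by positivity)]
      push_cast
      ring
    have hsq' : Real.sqrt (t : ℝ) ^ 2 = t := Real.sq_sqrt (by positivity)
    have h0 : 0 ≤ Real.sqrt (t : ℝ) := Real.sqrt_nonneg _
    have hstep : 1 / Real.sqrt ((t + 1 : ℕ) : ℝ)
        ≤ 2 * Real.sqrt ((t + 1 : ℕ) : ℝ) - 2 * Real.sqrt t := by
      rw [div_le_iff₀ hpos]
      nlinarith [sq_nonneg (Real.sqrt ((t + 1 : ℕ) : ℝ) - Real.sqrt t)]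
    linarith

/-- An exact closed form, so that the induction closes; only the leading term `6 · 2^{-h}` is used
later. -/
lemma sum_half_pow_mul_le {h m : ℕ} (hm : h ≤ m) :
    ∑ i ∈ Finset.Ioc h m, (1 / 2 : ℝ) ^ (i - 1) * ((i : ℝ) - h + 1)
      = 6 * (1 / 2) ^ h - 2 * ((m : ℝ) - h + 3) * (1 / 2) ^ m := by
  induction m, hm using Nat.le_induction with
  | base => simp; ring
  | succ m hm ih =>
    rw [Finset.sum_Ioc_succ_top (by omega), ih, Nat.add_sub_cancel, pow_succ]
    push_cast
    ring

lemma sum_half_pow_mul_sqrt_le {h m : ℕ} (hm : h ≤ m) :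
    ∑ i ∈ Finset.Ioc h m, (1 / 2 : ℝ) ^ (i - 1) * Real.sqrt ((i : ℝ) + 1)
      ≤ 6 * (Real.sqrt ((h : ℝ) + 1) * (1 / 2) ^ h) := by
  have hterm : ∀ i ∈ Finset.Ioc h m, (1 / 2 : ℝ) ^ (i - 1) * Real.sqrt ((i : ℝ) + 1)
      ≤ Real.sqrt ((h : ℝ) + 1) * ((1 / 2 : ℝ) ^ (i - 1) * ((i : ℝ) - h + 1)) := by
    intro i hi
    rw [Finset.mem_Ioc] at hi
    have hle : (h : ℝ) ≤ i := by exact_mod_cast hi.1.le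
    have hh : (0 : ℝ) ≤ h := Nat.cast_nonneg h
    -- Since `i + 1 ≤ (h + 1)(i - h + 1)`, the root grows at most linearly beyond depth `h`, which
    -- the geometric factor absorbs.
    have hsqrt : Real.sqrt ((i : ℝ) + 1) ≤ Real.sqrt ((h : ℝ) + 1) * ((i : ℝ) - h + 1) := by
      rw [Real.sqrt_le_iff]
      refine ⟨mul_nonneg (Real.sqrt_nonneg _) (by linarith), ?_⟩
      rw [mul_pow, Real.sq_sqrt (by positivity)]
      nlinarith [mul_nonneg hh (sub_nonneg.2 hle), sq_nonneg ((i : ℝ) - h),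
        mul_nonneg hh (sq_nonneg ((i : ℝ) - h))]
    rw [mul_left_comm]
    gcongr
  refine (Finset.sum_le_sum hterm).trans ?_
  rw [← Finset.mul_sum, sum_half_pow_mul_le hm]
  have hle : (h : ℝ) ≤ m := by exact_mod_cast hm
  have hnn : 0 ≤ 2 * ((m : ℝ) - h + 3) * (1 / 2 : ℝ) ^ m :=
    mul_nonneg (by linarith) (by positivity)
  calc Real.sqrt ((h : ℝ) + 1) * (6 * (1 / 2) ^ h - 2 * ((m : ℝ) - h + 3) * (1 / 2) ^ m)
      ≤ Real.sqrt ((h : ℝ) + 1) * (6 * (1 / 2) ^ h) := by gcongr; linarith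
    _ = 6 * (Real.sqrt ((h : ℝ) + 1) * (1 / 2) ^ h) := by ring

/-! ### The regret bound under linearly growing entropy -/

section Entropy

variable {X Ω : Type*} [MeasurableSpace Ω] {P : Measure Ω} [IsProbabilityMeasure P]
  {f : X → Ω → ℝ} {noise : ℕ → Ω → ℝ} {k : X → X → ℝ} {η : ℝ}
  {T : ℕ → Finset X} {p : ℕ → X → X}

lemma depthLevel_le {a : ℝ} (ha : 1 < a) {B u : ℝ} (hB : 0 ≤ B) (hu : 0 < u) {n : ℕ → ℝ}
    (hn : ∀ i : ℕ, n i ≤ B * (i + 1)) {i : ℕ} (hi : 1 ≤ i) :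
    depthLevel u a n i
      ≤ (1 + B + a + Real.log (riemannZeta (a : ℂ)).re) * (1 + u) * ((i : ℝ) + 1) := by
  have hi0 : (1 : ℝ) ≤ i := by exact_mod_cast hi
  have hlog : Real.log i ≤ i := (Real.log_le_sub_one_of_pos (by linarith)).trans (by linarith)
  have hz := Real.log_nonneg (one_le_riemannZeta_re ha)
  rw [depthLevel, unionCost_eq ha hi]
  set L := Real.log (riemannZeta (a : ℂ)).re
  have h1 : a * Real.log i ≤ a * ((i : ℝ) + 1) := by gcongr; linarith
  have h2 : L ≤ L * ((i : ℝ) + 1) := le_mul_of_one_le_right hz (by linarith)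
  have h3 : u ≤ u * ((i : ℝ) + 1) := le_mul_of_one_le_right hu.le (by linarith)
  have h4 : 0 ≤ ((B + a + L) * u + 1) * ((i : ℝ) + 1) := by positivity
  linarith [hn i]

lemma roundLevel_le {a : ℝ} (ha : 1 < a) {B u : ℝ} (hB : 0 ≤ B) (hu : 0 < u) {n : ℕ → ℝ}
    (hn : ∀ i : ℕ, n i ≤ B * (i + 1)) {t : ℕ} (ht : 2 ≤ t) :
    roundLevel u a n halfLogDepth t
      ≤ (2 + 4 * B + a + 2 * Real.log (riemannZeta (a : ℂ)).re) * (1 + u) * Real.log t := by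
  have hlog := two_thirds_le_log ht
  have hz := Real.log_nonneg (one_le_riemannZeta_re ha)
  have hdepth := halfLogDepth_add_one_le (by omega) le_rfl ht
  rw [roundLevel, unionCost_eq ha (by omega)]
  set L := Real.log (riemannZeta (a : ℂ)).re
  set l := Real.log (t : ℝ)
  have h1 : n (halfLogDepth t) ≤ B * (4 * l) := (hn _).trans (by gcongr)
  -- As `2 log t ≥ 1`, terms constant in `t` are absorbed into multiples of `log t`.
  have h2 : L ≤ L * (2 * l) := le_mul_of_one_le_right hz (by linarith)
  have h3 : u ≤ u * (2 * l) := le_mul_of_one_le_right hu.le (by linarith)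
  have h4 : 0 ≤ (2 + (4 * B + a + 2 * L) * u) * l := by
    have : 0 ≤ l := by linarith
    positivity
  linarith

/-- An edge into depth `i` has length at most `ε_{i-1} = Δ 2^{-(i-1)}`, and its quantile is at most
that length times `√(2 v_i)` with `v_i` linear in `i`. The chaining sum is thus comparable to its
first term. -/
lemma IsNetTree.discretizationError_le (hT : IsNetTree k T p) (hf : IsCenteredGP P f k)
    {a : ℝ} (ha : 1 < a) {B u : ℝ} (hB : 0 ≤ B) (hu : 0 < u)
    (hn0 : ∀ i, 0 ≤ netSize k i) (hn : ∀ i : ℕ, netSize k i ≤ B * (i + 1)) (h : ℕ) :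
    discretizationError P f T p (depthLevel u a (netSize k)) h
      ≤ ((canonicalDiam k
          * Real.sqrt (2 * ((1 + B + a + Real.log (riemannZeta (a : ℂ)).re) * (1 + u)))
          * (6 * (Real.sqrt ((h : ℝ) + 1) * (1 / 2) ^ h)) : ℝ) : EReal) := by
  refine iSup₂_le fun m hm => iSup₂_le fun x hx => EReal.coe_le_coe_iff.2 ?_
  have hz := Real.log_nonneg (one_le_riemannZeta_re ha)
  set A := (1 + B + a + Real.log (riemannZeta (a : ℂ)).re) * (1 + u) with hA
  have hA0 : 0 ≤ A := by positivity
  have hterm : ∀ i ∈ Finset.Ioc h m,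
      incrementBound P f (depthLevel u a (netSize k) i) (ancestor p m i x)
        (ancestor p m (i - 1) x)
      ≤ canonicalDiam k * Real.sqrt (2 * A)
        * ((1 / 2 : ℝ) ^ (i - 1) * Real.sqrt ((i : ℝ) + 1)) := by
    intro i hi
    rw [Finset.mem_Ioc] at hi
    obtain ⟨j, rfl⟩ : ∃ j, i = j + 1 := ⟨i - 1, by omega⟩
    have hv : 0 < depthLevel u a (netSize k) (j + 1) :=
      add_pos_of_pos_of_nonneg (add_pos_of_pos_of_nonneg hu (hn0 _))
        (unionCost_nonneg ha (by omega))
    have hvle := depthLevel_le ha hB hu hn (i := j + 1) (by omega)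
    have hd := hT.dist_parent j _ (ancestor_mem hT.isTree hi.2 hx)
    rw [Nat.add_sub_cancel, ancestor_eq_parent hi.2]
    refine (hf.incrementBound_le _ _ hv).trans ?_
    calc _ ≤ netRadius k j * Real.sqrt (2 * (A * (((j + 1 : ℕ) : ℝ) + 1))) := by
          gcongr
          exact (canonicalDist_nonneg k _ _).trans hd
      _ = _ := by
          rw [← mul_assoc 2, Real.sqrt_mul (by positivity), netRadius]
          ring
  refine (Finset.sum_le_sum hterm).trans ?_
  rw [← Finset.mul_sum]
  exact mul_le_mul_of_nonneg_left (sum_half_pow_mul_sqrt_le hm)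
    (mul_nonneg (canonicalDiam_nonneg k) (Real.sqrt_nonneg _))

/-- Parallelogram law: the variance of `f x + f y`, which is nonnegative, makes up the difference.
-/
lemma IsCenteredGP.canonicalDist_sq_le (h : IsCenteredGP P f k) (x y : X) :
    canonicalDist k x y ^ 2 ≤ 2 * (k x x + k y y) := by
  have h0 : 0 ≤ k x x - 2 * k x y + k y y := by
    rw [← h.variance_sub]
    exact variance_nonneg _ _
  have hadd : 0 ≤ k x x + 2 * k x y + k y y := by
    have := variance_nonneg (fun ω => f x ω + f y ω) P
    rwa [variance_fun_add (h.memLp x) (h.memLp y), h.variance_eq, h.variance_eq, h.covariance]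
      at this
  rw [canonicalDist, Real.sq_sqrt h0]
  linarith

lemma IsCenteredGP.canonicalDiam_le (h : IsCenteredGP P f k) {κ : ℝ} (hk : ∀ x, k x x ≤ κ) :
    canonicalDiam k ≤ 2 * Real.sqrt κ := by
  refine Real.iSup_le (fun q => ?_) (by positivity)
  have h1 := h.canonicalDist_sq_le q.1 q.2
  have hκ : 0 ≤ κ := (h.kernel_self_nonneg q.1).trans (hk _)
  refine le_of_sq_le_sq ?_ (by positivity)
  rw [mul_pow, Real.sq_sqrt hκ]
  linarith [hk q.1, hk q.2]

/-- A process with large diameter has a point with large variance, hence a positive information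
gain, so that the diameter is bounded by the information gain. -/
lemma IsGPBandit.canonicalDiam_le_sqrt_maxInfoGain (h : IsGPBandit P f noise k η) (hη : 0 < η)
    {κ δ : ℝ} (hδ : 0 < δ) (hk : ∀ x, k x x ≤ κ)
    (hdiam : canonicalDiam k = 0 ∨ δ ≤ canonicalDiam k) {t : ℕ} (ht : 1 ≤ t) :
    canonicalDiam k
      ≤ 2 * Real.sqrt κ / Real.sqrt (1 / 2 * Real.log (1 + (η ^ 2)⁻¹ * (δ ^ 2 / 16)))
        * Real.sqrt (maxInfoGain k η t) := by
  rcases hdiam with h0 | hle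
  · rw [h0]
    positivity
  have hg : 0 < 1 / 2 * Real.log (1 + (η ^ 2)⁻¹ * (δ ^ 2 / 16)) := by
    have : 0 < Real.log (1 + (η ^ 2)⁻¹ * (δ ^ 2 / 16)) :=
      Real.log_pos (by rw [lt_add_iff_pos_right]; positivity)
    positivity
  have hX : Nonempty (X × X) := by
    by_contra hemp
    rw [not_nonempty_iff] at hemp
    rw [canonicalDiam, Real.iSup_of_isEmpty] at hle
    linarith
  -- The supremum need not be attained, so half of `δ` is given up. Then `δ²/4 ≤ 2 (k(x,x) +
  -- k(y,y))`, and the larger variance is at least `δ²/16`.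
  obtain ⟨q, hq⟩ := exists_lt_of_lt_ciSup (show δ / 2 < canonicalDiam k by linarith)
  have hsq : (δ / 2) ^ 2 ≤ 2 * (k q.1 q.1 + k q.2 q.2) :=
    (pow_le_pow_left₀ (by positivity) hq.le 2).trans (h.gp.canonicalDist_sq_le _ _)
  obtain ⟨x, hx⟩ : ∃ x, δ ^ 2 / 16 ≤ k x x := by
    rcases le_total (k q.1 q.1) (k q.2 q.2) with hc | hc
    · exact ⟨q.2, by linarith⟩
    · exact ⟨q.1, by linarith⟩
  have hγ : 1 / 2 * Real.log (1 + (η ^ 2)⁻¹ * (δ ^ 2 / 16)) ≤ maxInfoGain k η t := by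
    refine le_trans ?_ (h.log_le_maxInfoGain hη hk x ht)
    gcongr
  have hsqrt := Real.sqrt_le_sqrt hγ
  have hpos := Real.sqrt_pos.2 hg
  rw [div_mul_eq_mul_div, le_div_iff₀ hpos]
  refine mul_le_mul (h.gp.canonicalDiam_le hk) hsqrt hpos.le (by positivity)

/-- The depth contributes `√(h(i)+1) ≤ 2 √(log t)` and `2^{-h(i)} ≤ i^{-1/2}`, whose sum is at most
`2 √t`; hence `24 = 6 · 2 · 2`. -/
lemma sum_discretizationError_le {W : ℕ → EReal} {E : ℝ} (hE : 0 ≤ E)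
    (hW : ∀ h : ℕ, W h ≤ ((E * (6 * (Real.sqrt ((h : ℝ) + 1) * (1 / 2) ^ h)) : ℝ) : EReal))
    {t : ℕ} (ht : 2 ≤ t) :
    ∑ i ∈ Finset.Icc 1 t, W (halfLogDepth i)
      ≤ ((24 * E * Real.sqrt (t * Real.log t) : ℝ) : EReal) := by
  have hlog : 0 ≤ Real.log t := by linarith [two_thirds_le_log ht]
  have hterm : ∀ i ∈ Finset.Icc 1 t, W (halfLogDepth i)
      ≤ ((12 * E * Real.sqrt (Real.log t) * (1 / Real.sqrt i) : ℝ) : EReal) := by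
    intro i hi
    rw [Finset.mem_Icc] at hi
    refine (hW _).trans (EReal.coe_le_coe_iff.2 ?_)
    have h1 : Real.sqrt ((halfLogDepth i : ℝ) + 1) ≤ 2 * Real.sqrt (Real.log t) := by
      refine (Real.sqrt_le_sqrt (halfLogDepth_add_one_le hi.1 hi.2 ht)).trans_eq ?_
      rw [Real.sqrt_mul (by norm_num), show (4 : ℝ) = 2 ^ 2 by norm_num,
        Real.sqrt_sq two_pos.le]
    calc _ ≤ E * (6 * (2 * Real.sqrt (Real.log t) * (1 / Real.sqrt i))) := by
          gcongr
          exact half_pow_halfLogDepth_le hi.1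
      _ = _ := by ring
  refine (Finset.sum_le_sum hterm).trans ?_
  have hcoe : ∑ i ∈ Finset.Icc 1 t,
        ((12 * E * Real.sqrt (Real.log t) * (1 / Real.sqrt i) : ℝ) : EReal)
      = ((∑ i ∈ Finset.Icc 1 t, 12 * E * Real.sqrt (Real.log t) * (1 / Real.sqrt i) : ℝ) :
        EReal) := by
    induction Finset.Icc 1 t using Finset.cons_induction with
    | empty => simp
    | cons i s hi ih => rw [Finset.sum_cons, Finset.sum_cons, EReal.coe_add, ih]
  rw [hcoe, EReal.coe_le_coe_iff, ← Finset.mul_sum, Real.sqrt_mul (by positivity)]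
  calc _ ≤ 12 * E * Real.sqrt (Real.log t) * (2 * Real.sqrt t) := by
        gcongr
        exact sum_one_div_sqrt_le t
    _ = _ := by ring

/-- The first summand of `C` comes from `u_t` being of order `(1+u) log t`. The second comes from
the discretization errors, where `Δ ≤ Γ √γ_t` supplies the information gain; this is where the
dichotomy on the diameter enters. -/
theorem exists_netUCBRegretGuarantee_of_entropy (hη : 0 < η) {a : ℝ} (ha : 1 < a) {κ δ B : ℝ}
    (hκ : 0 < κ) (hδ : 0 < δ) (hB : 0 ≤ B) :
    ∃ C : ℝ, 0 < C ∧ ∀ (X : Type*) (k : X → X → ℝ), (∀ x, k x x ≤ κ) →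
      (canonicalDiam k = 0 ∨ δ ≤ canonicalDiam k) →
      (∀ i : ℕ, netSize k i ≤ B * (i + 1)) → NetUCBRegretGuarantee k η κ a C := by
  have hz := Real.log_nonneg (one_le_riemannZeta_re ha)
  set A₁ := 1 + B + a + Real.log (riemannZeta (a : ℂ)).re with hA₁
  set A₂ := 2 + 4 * B + a + 2 * Real.log (riemannZeta (a : ℂ)).re with hA₂
  have hA₁0 : 0 < A₁ := by positivity
  have hA₂0 : 0 < A₂ := by positivity
  have hc := infoConst_pos hκ hη
  set Γ := 2 * Real.sqrt κ / Real.sqrt (1 / 2 * Real.log (1 + (η ^ 2)⁻¹ * (δ ^ 2 / 16))) with hΓ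
  have hΓ0 : 0 ≤ Γ := by positivity
  refine ⟨2 * Real.sqrt (2 * infoConst κ η * A₂) + 24 * Γ * Real.sqrt (2 * A₁), by positivity,
    ?_⟩
  intro X k hk hdiam hent T p hT u hu Ω _ P _ f noise x hbandit hrun
  obtain ⟨ω₀⟩ : Nonempty Ω := nonempty_of_isProbabilityMeasure P
  have : Nonempty X := ⟨x 0 ω₀⟩
  have hn0 : ∀ i, 0 ≤ netSize k i := fun i =>
    mul_nonneg two_pos.le (Real.log_natCast_nonneg _)
  refine ⟨hbandit.measure_not_cumRegret_le hη ha hκ hk hT.netSize_mono hT.isTree hT.card_le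
    hT.dense halfLogDepth_mono hu hrun, fun t ht => ?_⟩
  have hlog : 0 ≤ Real.log t := by linarith [two_thirds_le_log ht]
  have hdiam0 := canonicalDiam_nonneg k
  have hsum := sum_discretizationError_le (E := canonicalDiam k * Real.sqrt (2 * (A₁ * (1 + u))))
    (by positivity) (fun h => hT.discretizationError_le hbandit.gp ha hB hu hn0 hent h) ht
  have hγ0 : 0 ≤ maxInfoGain k η t := by
    have hx0 := hbandit.gp.kernel_self_nonneg (x 0 ω₀)
    refine le_trans ?_ (hbandit.log_le_maxInfoGain hη hk (x 0 ω₀) (by omega))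
    have : 0 ≤ Real.log (1 + (η ^ 2)⁻¹ * k (x 0 ω₀) (x 0 ω₀)) :=
      Real.log_nonneg (by rw [le_add_iff_nonneg_right]; positivity)
    positivity
  have hΔ := hbandit.canonicalDiam_le_sqrt_maxInfoGain hη hδ hk hdiam (t := t) (by omega)
  rw [← hΓ] at hΔ
  set γ := maxInfoGain k η t with hγ
  rw [regretBound]
  refine (add_le_add le_rfl hsum).trans ?_
  rw [← EReal.coe_add, EReal.coe_le_coe_iff, ← hγ]
  have hfirst : 2 * Real.sqrt (2 * infoConst κ η * t
        * roundLevel u a (netSize k) halfLogDepth t * γ)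
      ≤ 2 * Real.sqrt (2 * infoConst κ η * A₂) * Real.sqrt (1 + u)
        * Real.sqrt (t * γ * Real.log t) := by
    have hlev := roundLevel_le ha hB hu hent ht
    calc _ ≤ 2 * Real.sqrt (2 * infoConst κ η * t * (A₂ * (1 + u) * Real.log t) * γ) := by gcongr
      _ = 2 * Real.sqrt (2 * infoConst κ η * A₂ * (1 + u) * (t * γ * Real.log t)) := by
        congr 2
        ring
      _ = _ := by
        rw [Real.sqrt_mul (by positivity), Real.sqrt_mul (by positivity)]
        ring
  have hsecond : 24 * (canonicalDiam k * Real.sqrt (2 * (A₁ * (1 + u))))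
        * Real.sqrt (t * Real.log t)
      ≤ 24 * Γ * Real.sqrt (2 * A₁) * Real.sqrt (1 + u) * Real.sqrt (t * γ * Real.log t) := by
    calc _ ≤ 24 * (Γ * Real.sqrt γ * Real.sqrt (2 * (A₁ * (1 + u))))
          * Real.sqrt (t * Real.log t) := by gcongr
      _ = _ := by
        rw [← mul_assoc 2 A₁, Real.sqrt_mul (by positivity) (1 + u),
          show (t : ℝ) * γ * Real.log t = γ * (t * Real.log t) by ring, Real.sqrt_mul hγ0]
        ring
  refine (add_le_add hfirst hsecond).trans_eq ?_
  ring

end Entropy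

/-! ### Entropy of subsets of a cube -/

section Cube

variable {X : Type*} {k : X → X → ℝ} {D : ℕ} {g : X → Fin D → ℝ} {R : ℝ}

/-- Cut the cube into cells of side `s` and take one point of `X` from each occupied cell, so that
the centers lie in `X`. On empty cells `Function.invFun` returns an arbitrary point, which does no
harm. -/
lemma exists_net_of_cube [Nonempty X] (hg : ∀ x j, 0 ≤ g x j ∧ g x j ≤ R) {s r : ℝ} (hs : 0 < s)
    (hd : ∀ x y, (∀ j, |g x j - g y j| ≤ s) → canonicalDist k x y ≤ r) :
    ∃ S : Finset X, S.card ≤ (⌊R / s⌋₊ + 1) ^ D ∧ IsCanonicalNet k r S := by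
  classical
  let q : X → Fin D → Fin (⌊R / s⌋₊ + 1) := fun x j =>
    ⟨⌊g x j / s⌋₊, Nat.lt_succ_of_le (Nat.floor_mono (by gcongr; exact (hg x j).2))⟩
  refine ⟨Finset.univ.image (Function.invFun q), ?_, fun x => ?_⟩
  · refine Finset.card_image_le.trans ?_
    simp
  · refine ⟨Function.invFun q (q x), Finset.mem_image_of_mem _ (Finset.mem_univ _), hd _ _ ?_⟩
    intro j
    have hq : q (Function.invFun q (q x)) = q x := Function.invFun_eq ⟨x, rfl⟩
    set y := Function.invFun q (q x)
    have hfloor : ⌊g y j / s⌋₊ = ⌊g x j / s⌋₊ := congrArg Fin.val (congrFun hq j)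
    have hx1 := Nat.floor_le (div_nonneg (hg x j).1 hs.le)
    have hy1 := Nat.floor_le (div_nonneg (hg y j).1 hs.le)
    have hx2 := Nat.lt_floor_add_one (g x j / s)
    have hy2 := Nat.lt_floor_add_one (g y j / s)
    rw [hfloor] at hy1 hy2
    have habs : |g x j / s - g y j / s| ≤ 1 := by
      rw [abs_le]
      constructor <;> linarith
    rwa [← sub_div, abs_div, abs_of_pos hs, div_le_one hs] at habs

/-- The mesh `s₀ ρ^i`, with `c s₀^α = δ` and `ρ^α = 1/2`, gives cells of diameter at most `δ 2^{-i}
≤ ε_i`. Its cell count is geometric in `i`, so the entropy is linear. The absolute value of `R`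
keeps the constant meaningful for negative `R`. -/
lemma netSize_le_of_holder {c α δ : ℝ} (hc : 0 < c) (hα : 0 < α) (hδ : 0 < δ)
    (hg : ∀ x j, 0 ≤ g x j ∧ g x j ≤ R)
    (hd : ∀ x y s, 0 ≤ s → (∀ j, |g x j - g y j| ≤ s) → canonicalDist k x y ≤ c * s ^ α)
    (hdiam : canonicalDiam k = 0 ∨ δ ≤ canonicalDiam k) (i : ℕ) :
    netSize k i ≤ 2 * D * (Real.log (|R| / (δ / c) ^ α⁻¹ + 1)
      + Real.log ((1 / 2 : ℝ) ^ α⁻¹)⁻¹) * (i + 1) := by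
  set s₀ := (δ / c) ^ α⁻¹ with hs₀
  set ρ := (1 / 2 : ℝ) ^ α⁻¹ with hρ
  have hs₀0 : 0 < s₀ := by positivity
  have hρ0 : 0 < ρ := by positivity
  have hρ1 : 1 ≤ ρ⁻¹ :=
    (one_le_inv₀ hρ0).2 (Real.rpow_le_one (by norm_num) (by norm_num) (by positivity))
  have hL : 0 ≤ Real.log (|R| / s₀ + 1) :=
    Real.log_nonneg (by rw [le_add_iff_nonneg_left]; positivity)
  have hL' : 0 ≤ Real.log ρ⁻¹ := Real.log_nonneg hρ1
  have hbound : 0 ≤ 2 * D * (Real.log (|R| / s₀ + 1) + Real.log ρ⁻¹) * ((i : ℝ) + 1) := by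
    positivity
  rcases isEmpty_or_nonempty X with hX | hX
  · have hcov : canonicalCoveringNumber k (netRadius k i) = 0 :=
      Nat.le_zero.1 (canonicalCoveringNumber_le (S := ∅) fun x => hX.elim x)
    rw [netSize, hcov, Nat.cast_zero, Real.log_zero, mul_zero]
    exact hbound
  rcases hdiam with h0 | hle
  -- Boundedness is essential here: the real supremum of an unbounded family is `0`, so only with
  -- `hbdd` does a zero diameter force all distances to vanish.
  · have hbdd : BddAbove (Set.range fun q : X × X => canonicalDist k q.1 q.2) := by
      refine ⟨c * |R| ^ α, ?_⟩
      rintro _ ⟨q, rfl⟩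
      refine hd _ _ _ (abs_nonneg R) fun j => ?_
      have h1 := hg q.1 j
      have h2 := hg q.2 j
      refine le_trans ?_ (le_abs_self R)
      rw [abs_le]
      constructor <;> linarith
    have hcov : canonicalCoveringNumber k (netRadius k i) ≤ 1 := by
      refine canonicalCoveringNumber_le (S := {Classical.arbitrary X}) fun x => ?_
      refine ⟨_, Finset.mem_singleton_self _, ?_⟩
      rw [netRadius, h0, zero_mul, ← h0]
      exact le_ciSup hbdd (x, Classical.arbitrary X)
    rw [netSize]
    have : Real.log (canonicalCoveringNumber k (netRadius k i)) ≤ 0 :=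
      Real.log_nonpos (Nat.cast_nonneg _) (by exact_mod_cast hcov)
    linarith
  · have hsα : c * (s₀ * ρ ^ i) ^ α ≤ netRadius k i := by
      have h1 : (s₀ * ρ ^ i) ^ α = δ / c * (1 / 2) ^ i := by
        rw [Real.mul_rpow hs₀0.le (by positivity), ← Real.rpow_natCast, ← Real.rpow_mul hρ0.le,
          mul_comm (i : ℝ), Real.rpow_mul hρ0.le, hs₀, hρ,
          Real.rpow_inv_rpow (by positivity) hα.ne', Real.rpow_inv_rpow (by norm_num) hα.ne',
          Real.rpow_natCast]
      rw [h1, ← mul_assoc, mul_div_cancel₀ _ hc.ne', netRadius]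
      gcongr
    have hs : 0 < s₀ * ρ ^ i := by positivity
    obtain ⟨S, hS, hnet⟩ := exists_net_of_cube (k := k) (r := netRadius k i) hg hs
      fun x y hxy => (hd x y _ hs.le hxy).trans hsα
    obtain ⟨S', hS', hnet'⟩ := exists_minimal_net hnet
    have hpos : 0 < canonicalCoveringNumber k (netRadius k i) := by
      rw [← hS', Finset.card_pos]
      obtain ⟨y, hy, -⟩ := hnet' (Classical.arbitrary X)
      exact ⟨y, hy⟩
    have hcov : (canonicalCoveringNumber k (netRadius k i) : ℝ)
        ≤ ((|R| / s₀ + 1) * ρ⁻¹ ^ i) ^ D := by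
      have hnat : (canonicalCoveringNumber k (netRadius k i) : ℝ)
          ≤ ((⌊R / (s₀ * ρ ^ i)⌋₊ : ℝ) + 1) ^ D := by
        exact_mod_cast (canonicalCoveringNumber_le hnet).trans hS
      refine hnat.trans (pow_le_pow_left₀ (by positivity) ?_ D)
      have h1 : (⌊R / (s₀ * ρ ^ i)⌋₊ : ℝ) ≤ |R| / (s₀ * ρ ^ i) :=
        (Nat.cast_le.2 (Nat.floor_mono (by gcongr; exact le_abs_self R))).trans
          (Nat.floor_le (by positivity))
      have h2 : |R| / (s₀ * ρ ^ i) = |R| / s₀ * ρ⁻¹ ^ i := by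
        rw [inv_pow]
        field_simp
      -- Lets the `+ 1` from rounding be absorbed into the geometric factor.
      have h3 : 1 ≤ ρ⁻¹ ^ i := one_le_pow₀ hρ1
      rw [add_mul, one_mul]
      linarith
    have hlog := Real.log_le_log (by exact_mod_cast hpos) hcov
    rw [Real.log_pow, Real.log_mul (by positivity) (by positivity), Real.log_pow] at hlog
    have hi : (0 : ℝ) ≤ i := Nat.cast_nonneg i
    rw [netSize]
    calc _ ≤ 2 * (D * (Real.log (|R| / s₀ + 1) + i * Real.log ρ⁻¹)) := by gcongr
      _ ≤ 2 * (D * ((Real.log (|R| / s₀ + 1) + Real.log ρ⁻¹) * ((i : ℝ) + 1))) := by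
        gcongr
        nlinarith [mul_nonneg hL hi]
      _ = _ := by ring

/-- Stated for coordinates `g` and a coordinatewise Hölder condition, so that it serves both
Euclidean subsets and subsets of the line. -/
theorem exists_netUCBRegretGuarantee_of_holder {η : ℝ} (hη : 0 < η) {a : ℝ} (ha : 1 < a)
    (D : ℕ) (R : ℝ) {c α κ δ : ℝ} (hc : 0 < c) (hα : 0 < α) (hκ : 0 < κ) (hδ : 0 < δ) :
    ∃ C : ℝ, 0 < C ∧ ∀ (X : Type*) (k : X → X → ℝ) (g : X → Fin D → ℝ),
      (∀ x j, 0 ≤ g x j ∧ g x j ≤ R) → (∀ x, k x x ≤ κ) →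
      (∀ x y s, 0 ≤ s → (∀ j, |g x j - g y j| ≤ s) → canonicalDist k x y ≤ c * s ^ α) →
      (canonicalDiam k = 0 ∨ δ ≤ canonicalDiam k) → NetUCBRegretGuarantee k η κ a C := by
  have hL : 0 ≤ Real.log (|R| / (δ / c) ^ α⁻¹ + 1) :=
    Real.log_nonneg (by rw [le_add_iff_nonneg_left]; positivity)
  have hL' : 0 ≤ Real.log ((1 / 2 : ℝ) ^ α⁻¹)⁻¹ :=
    Real.log_nonneg ((one_le_inv₀ (by positivity)).2
      (Real.rpow_le_one (by norm_num) (by norm_num) (by positivity)))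
  obtain ⟨C, hC, hguar⟩ := exists_netUCBRegretGuarantee_of_entropy hη ha
    (B := 2 * D * (Real.log (|R| / (δ / c) ^ α⁻¹ + 1) + Real.log ((1 / 2 : ℝ) ^ α⁻¹)⁻¹))
    hκ hδ (by positivity)
  exact ⟨C, hC, fun X k g hg hk hd hdiam => hguar X k hk hdiam
    (netSize_le_of_holder hc hα hδ hg hd hdiam)⟩

end Cube

/-- Compares the Euclidean norm with the largest coordinate. The factors `|c| + 1` and `D + 1` keep
the new constant positive even if `c ≤ 0` or `D = 0`. -/
lemma canonicalDist_le_of_norm_le {D : ℕ} {X : Set (EuclideanSpace ℝ (Fin D))} {k : X → X → ℝ}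
    {c α : ℝ} (hα : 0 < α)
    (hk : ∀ x y : X, canonicalDist k x y ≤ c * ‖(x : EuclideanSpace ℝ (Fin D)) - y‖ ^ α)
    (x y : X) {s : ℝ} (hs : 0 ≤ s)
    (hxy : ∀ j, |(x : EuclideanSpace ℝ (Fin D)) j - (y : EuclideanSpace ℝ (Fin D)) j| ≤ s) :
    canonicalDist k x y ≤ (|c| + 1) * ((D : ℝ) + 1) ^ α * s ^ α := by
  have hnorm : ‖(x : EuclideanSpace ℝ (Fin D)) - y‖ ≤ ((D : ℝ) + 1) * s := by
    rw [EuclideanSpace.norm_eq, Real.sqrt_le_iff]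
    refine ⟨by positivity, ?_⟩
    have hsum : ∑ j, ‖((x : EuclideanSpace ℝ (Fin D)) - y) j‖ ^ 2 ≤ ∑ _j : Fin D, s ^ 2 := by
      refine Finset.sum_le_sum fun j _ => pow_le_pow_left₀ (norm_nonneg _) ?_ 2
      simpa using hxy j
    refine hsum.trans ?_
    rw [Finset.sum_const, Finset.card_univ, Fintype.card_fin, nsmul_eq_mul, mul_pow]
    gcongr
    nlinarith [(Nat.cast_nonneg D : (0 : ℝ) ≤ D)]
  rw [mul_assoc, ← Real.mul_rpow (by positivity) hs]
  refine (hk x y).trans ?_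
  gcongr
  linarith [le_abs_self c]

/-- From `1 - e^{-r} ≤ r`, the squared distance `2σ² (1 - e^{-θ|x-y|})` is at most `2σ²θ |x-y|`: a
Hölder bound with exponent `1/2`. -/
lemma canonicalDist_ouKernel_le {σ θ : ℝ} (hσ : 0 < σ) (hθ : 0 < θ) {X : Set ℝ} (x y : X) {s : ℝ}
    (hxy : |(x : ℝ) - y| ≤ s) :
    canonicalDist (ouKernel σ θ) x y ≤ σ * Real.sqrt (2 * θ) * s ^ (1 / 2 : ℝ) := by
  have hs : 0 ≤ s := (abs_nonneg _).trans hxy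
  rw [← Real.sqrt_eq_rpow, canonicalDist, Real.sqrt_le_iff]
  refine ⟨by positivity, ?_⟩
  rw [mul_pow, mul_pow, Real.sq_sqrt (by positivity), Real.sq_sqrt hs]
  have hexp := Real.add_one_le_exp (-θ * |(x : ℝ) - y|)
  have hle : θ * |(x : ℝ) - y| ≤ θ * s := by gcongr
  have hmul : σ ^ 2 * (1 - Real.exp (-θ * |(x : ℝ) - y|)) ≤ σ ^ 2 * (θ * s) := by
    gcongr
    linarith
  simp only [ouKernel, sub_self, abs_zero, mul_zero, Real.exp_zero, mul_one]
  linarith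

theorem mainTheorem4
    (η : ℝ) (hη : 0 < η) (a : ℝ) (ha : 1 < a) :
    -- the bound for an arbitrary index set, an arbitrary tree and nondecreasing depths
    (∀ (κ : ℝ), 0 < κ →
      ∀ (X : Type*) (k : X → X → ℝ), (∀ x, k x x ≤ κ) →
      ∀ (n : ℕ → ℝ), Monotone n →
      ∀ (T : ℕ → Finset X) (p : ℕ → X → X), IsTree T p →
        (∀ h, ((T h).card : ℝ) ≤ Real.exp (n h)) →
        (∀ x : X, ∀ r > 0, ∃ᶠ m in atTop, ∃ y ∈ T m, canonicalDist k x y < r) →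
      ∀ (depth : ℕ → ℕ), Monotone depth →
      ∀ u : ℝ, 0 < u →
      ∀ (Ω : Type*) [MeasurableSpace Ω] (P : Measure Ω) [IsProbabilityMeasure P]
        (f : X → Ω → ℝ) (noise : ℕ → Ω → ℝ) (x : ℕ → Ω → X),
        IsGPBandit P f noise k η →
        IsUCBRun f noise k η T depth (roundLevel u a n depth) x →
        P {ω | ¬ ∀ t : ℕ, 1 ≤ t → cumRegret f x t ω ≤ regretBound P f k η κ u a n T p depth t}
          ≤ ENNReal.ofReal (2 * Real.exp (-u))) ∧
    -- subsets of a cube, with a canonical pseudo-metric bounded by a power of the Euclidean norm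
    (∀ (D : ℕ) (R c α κ δ : ℝ), 0 < α → α ≤ 1 → 0 < κ → 0 < δ →
      ∃ C : ℝ, 0 < C ∧
        ∀ (X : Set (EuclideanSpace ℝ (Fin D))) (k : X → X → ℝ),
          (∀ x ∈ X, ∀ j, 0 ≤ x j ∧ x j ≤ R) →
          (∀ x, k x x ≤ κ) →
          (∀ x y : X, canonicalDist k x y ≤ c * ‖(x : EuclideanSpace ℝ (Fin D)) - y‖ ^ α) →
          (canonicalDiam k = 0 ∨ δ ≤ canonicalDiam k) →
          NetUCBRegretGuarantee k η κ a C) ∧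
    -- the Ornstein-Uhlenbeck process
    (∀ (R σ θ δ : ℝ), 0 < σ → 0 < θ → 0 < δ →
      ∃ C : ℝ, 0 < C ∧
        ∀ X : Set ℝ, X ⊆ Set.Icc 0 R →
          (canonicalDiam (ouKernel σ θ : X → X → ℝ) = 0 ∨
            δ ≤ canonicalDiam (ouKernel σ θ : X → X → ℝ)) →
          NetUCBRegretGuarantee (ouKernel σ θ : X → X → ℝ) η (σ ^ 2) a C)
 := by
  refine ⟨?_, ?_, ?_⟩
  · intro κ hκ X k hk n hn T p hT hcard hdense depth hdepth u hu Ω _ P _ f noise x hB hx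
    exact hB.measure_not_cumRegret_le hη ha hκ hk hn hT hcard hdense hdepth hu hx
  · intro D R c α κ δ hα _ hκ hδ
    obtain ⟨C, hC, hguar⟩ := exists_netUCBRegretGuarantee_of_holder hη ha D R
      (c := (|c| + 1) * ((D : ℝ) + 1) ^ α) (by positivity) hα hκ hδ
    exact ⟨C, hC, fun X k hX hk hd hdiam => hguar X k
      (fun x j => (x : EuclideanSpace ℝ (Fin D)) j) (fun x j => hX x x.2 j) hk
      (fun x y s hs hxy => canonicalDist_le_of_norm_le hα hd x y hs hxy) hdiam⟩
  · intro R σ θ δ hσ hθ hδ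
    obtain ⟨C, hC, hguar⟩ := exists_netUCBRegretGuarantee_of_holder hη ha 1 R
      (c := σ * Real.sqrt (2 * θ)) (α := 1 / 2) (κ := σ ^ 2) (by positivity) (by norm_num)
      (by positivity) hδ
    exact ⟨C, hC, fun X hX hdiam => hguar X (ouKernel σ θ) (fun x _ => (x : ℝ))
      (fun x _ => hX x.2) (fun x => by simp [ouKernel])
      (fun x y s _ hxy => canonicalDist_ouKernel_le hσ hθ x y (hxy 0)) hdiam⟩
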